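/- A real square matrix $A\ge 0$ is primitive if $A^m>0$ entrywise for some $m\ge 1$; the least such $m$ is its exponent $\exp(A)$. For a set $X$ of matrices put $E(X)=\{\exp(A): A\in X \text{ primitive}\}$. For integers $1\le a\le b$, $[a,b]^e$ and $[a,b]^o$ denote the sets of even, respectively odd, integers $x$ with $a\le x\le b$. For $n\ge 5$ let $PSC_n^{1,0}$ be the set of all primitive matrices of the form $A+A^T$, where $A$ is an $n\times n$ companion matrix (ones on the superdiagonal, arbitrary last row $(a_0,\dots,a_{n-1})$, zeros elsewhere) with $a_i\in\{0,1\}$, $a_0=1$ and $a_{n-1}=0$. The last row of such a matrix $A+A^T$ has the form $[1,Y,c,0]$ with $c\in\{1,2\}$ and $Y\in\{0,1\}^{n-3}$. For $k\ge 0$ let $PSC_{n,k}^{1,0}$ be the set of those matrices in $PSC_n^{1,0}$ for which the longest block of consecutive zeros in $Y$ has length exactly $k$. **Theorem.** Let $n\ge 5$ and $k\ge 1$ be integers. 1. If $n$ is odd and $n\ge 2(k+2)+1$, or if $n$ is even and $n\ge 3(k+2)-1$, then $E(PSC_{n,k}^{1,0})=[k+2,2(k+2)]^e$. 2. If $k$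 is odd and $n\in[k+3,2(k+2)-1]^o$, then $E(PSC_{n,k}^{1,0})=[k+2,n-1]^e$. 3. If $k$ is even and $n\in[k+3,2(k+2)-1]^o\setminus\{k+5,k+7\}$, then $E(PSC_{n,k}^{1,0})=[k+2,n-1]^e\setminus\{k+4\}$. If $k$ is even and $n\in\{k+5,k+7\}$, then $E(PSC_{n,k}^{1,0})=[k+2,n-1]^e$. 4. If $k$ is odd and $n\in[k+5,3(k+1)]^e$, then $E(PSC_{n,k}^{1,0})=[k+3,l]^e$, where, with $d=n-k-4$ (which is odd), $$l=\begin{cases}k+2\lfloor d/4\rfloor+3 & \text{if } d=4\lfloor d/4\rfloor+1,\\ k+2\lfloor d/4\rfloor+5 & \text{if } d=4\lfloor d/4\rfloor+3.\end{cases}$$ 5. If $k$ is even and $n\in[k+4,3k+2]^e$, then $E(PSC_{n,k}^{1,0})=[k+2,n-k]^e$ when $n-k>k+2$, and $E(PSC_{n,k}^{1,0})=\{k+2\}$ when $n-k\le k+2$. If $k$ is even and $n=3(k+1)+1$, then $E(PSC_{n,k}^{1,0})=[k+2,2(k+1)]^e$. -/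

import Mathlib

open scoped Matrix

namespace SymCompanion

/-- The companion matrix of `x ^ n - ∑ i, a i * x ^ i`: ones on the superdiagonal and
last row `a` (indices start at `0`, so the last row is the row `i` with `i + 1 = n`). -/
def companion {n : ℕ} (a : Fin n → ℝ) : Matrix (Fin n) (Fin n) ℝ :=
  Matrix.of fun i j =>
    if (i : ℕ) + 1 = n then a j else if (j : ℕ) = (i : ℕ) + 1 then 1 else 0

/-- The set `C_n` of all `(0,1)` companion matrices of order `n`. -/
def zeroOneCompanion (n : ℕ) : Set (Matrix (Fin n) (Fin n) ℝ) :=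
  {A | ∃ a : Fin n → ℝ, (∀ i, a i = 0 ∨ a i = 1) ∧ A = companion a}

/-- The set `C_n^{α,e}` of the symmetric companion matrices `A + Aᵀ` where `A` is a `(0,1)`
companion matrix whose last row has first entry `α` and last entry `e`. -/
def symCompanion (n : ℕ) (α e : ℝ) : Set (Matrix (Fin n) (Fin n) ℝ) :=
  {B | ∃ A ∈ zeroOneCompanion n,
    (∀ i j : Fin n, (i : ℕ) + 1 = n → (j : ℕ) = 0 → A i j = α) ∧
    (∀ i : Fin n, (i : ℕ) + 1 = n → A i i = e) ∧
    B = A + Aᵀ}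

/-- The set `PSC_n^{α,e}` of the primitive matrices in `C_n^{α,e}`. -/
def psc (n : ℕ) (α e : ℝ) : Set (Matrix (Fin n) (Fin n) ℝ) :=
  {B | B ∈ symCompanion n α e ∧ B.IsPrimitive}

/-- The exponent of a primitive matrix: the least positive `m` such that all entries of `A ^ m`
are positive (for primitive `A` such an `m` exists). -/
noncomputable def exponent {n : ℕ} (A : Matrix (Fin n) (Fin n) ℝ) : ℕ :=
  sInf {m : ℕ | 0 < m ∧ ∀ i j, 0 < (A ^ m) i j}

/-- The exponent set `E(X)` of a set `X` of matrices. -/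
def exponentSet {n : ℕ} (X : Set (Matrix (Fin n) (Fin n) ℝ)) : Set ℕ :=
  {m | ∃ A ∈ X, A.IsPrimitive ∧ exponent A = m}

/-- The set `B_m^{q,k}` of the binary strings of length `m` with exactly `q` zeros whose longest
block of consecutive zeros has length `k`. -/
def binaryStrings (m q k : ℕ) : Set (Fin m → Fin 2) :=
  {Y | {t | Y t = 0}.ncard = q ∧
    IsGreatest {l : ℕ | ∃ s : ℕ, s + l ≤ m ∧
      ∀ t : Fin m, s ≤ (t : ℕ) → (t : ℕ) < s + l → Y t = 0} k}

/-- The last row of `A` is `[*, Y, *, *]`: `Y` occupies its entries number `2, …, n - 2`. -/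
def HasString {n : ℕ} (A : Matrix (Fin n) (Fin n) ℝ) (Y : Fin (n - 3) → Fin 2) : Prop :=
  ∀ (i j : Fin n) (t : Fin (n - 3)), (i : ℕ) + 1 = n → (j : ℕ) = (t : ℕ) + 1 →
    A i j = ((Y t : ℕ) : ℝ)

/-- The set `PSC_{n,k}^{1,0}` of the matrices `A_Y` in `PSC_n^{1,0}` such that the longest block
of zeros of the string `Y` has length `k`. -/
def pscRun (n k : ℕ) : Set (Matrix (Fin n) (Fin n) ℝ) :=
  {A | A ∈ psc n 1 0 ∧ ∃ (q : ℕ) (Y : Fin (n - 3) → Fin 2),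
    Y ∈ binaryStrings (n - 3) q k ∧ HasString A Y}

/-- `[a, b]^e`: the even integers in `[a, b]`. -/
def evenIcc (a b : ℕ) : Set ℕ := {x | x ∈ Set.Icc a b ∧ Even x}

/-- `[a, b]^o`: the odd integers in `[a, b]`. -/
def oddIcc (a b : ℕ) : Set ℕ := {x | x ∈ Set.Icc a b ∧ Odd x}

end SymCompanion

namespace SymCompanion

/-! Put n = N + 2 and K = k + 1. The positive entries of A + Aᵀ are the edges of a path 0, …, N
together with a hub N + 1 joined to the vertices satisfying P; both 0 and N are among them.
Consecutive hub neighbours bound gaps of the path, and a longest zero block of length k means a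
longest gap of length K.

Walks can be lengthened by 2, so the exponent is governed by odd closed walks. The path is
bipartite, so odd cycles pass through the hub; the shortest has length m + 2, where m is the
shortest odd gap. In the middle of a gap of length g, an odd closed walk leaves through the two ends
and needs g + 2 steps if g is odd. If g is even it needs g + m + 2 steps when some hub neighbour
lies at distance m beyond an end of the gap, and g + m + 4 otherwise (call such a gap isolated). The
exponent is the largest of these numbers, minus one: this is `IsHubMatrix.exponent_eq_gapCost`.

What remains is to decide which maxima occur when N is cut into gaps with longest gap K. The
exclusions are parity counts: the distance between two hub neighbours is even or at least m, so a
wrong parity of N forces a further odd piece of length at least m (`Profile.exists_pieces`). Every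
value not excluded comes from an explicit list of gaps. The parities of N and K give four cases. -/

/-! ### Walks in the hub graph -/

/-- Adjacency in the graph formed by the path `0, …, N` and a hub `N + 1` joined to the vertices
of the path that satisfy `P`. -/
def HubAdj (N : ℕ) (P : ℕ → Prop) (i j : ℕ) : Prop :=
  (i ≤ N ∧ j ≤ N ∧ (j = i + 1 ∨ i = j + 1)) ∨ (i = N + 1 ∧ j ≤ N ∧ P j) ∨
    (i ≤ N ∧ P i ∧ j = N + 1)

/-- `HubWalk N P l i j`: there is a walk of length `l` from `i` to `j`. -/
inductive HubWalk (N : ℕ) (P : ℕ → Prop) : ℕ → ℕ → ℕ → Prop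
  | nil (i : ℕ) : HubWalk N P 0 i i
  | cons {l i j k : ℕ} : HubAdj N P i j → HubWalk N P l j k → HubWalk N P (l + 1) i k

variable {N : ℕ} {P : ℕ → Prop}

theorem HubAdj.symm {i j : ℕ} (h : HubAdj N P i j) : HubAdj N P j i := by
  unfold HubAdj at *
  tauto

theorem HubAdj.left_le {i j : ℕ} (h : HubAdj N P i j) : i ≤ N + 1 := by
  unfold HubAdj at h
  omega

theorem HubWalk.trans {a b i j k : ℕ} (h : HubWalk N P a i j) (h' : HubWalk N P b j k) :
    HubWalk N P (a + b) i k := by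
  induction h with
  | nil i => simpa using h'
  | cons hs _ ih =>
    rw [Nat.add_right_comm]
    exact .cons hs (ih h')

theorem HubWalk.single {i j : ℕ} (h : HubAdj N P i j) : HubWalk N P 1 i j :=
  .cons h (.nil _)

theorem HubWalk.symm {a i j : ℕ} (h : HubWalk N P a i j) : HubWalk N P a j i := by
  induction h with
  | nil i => exact .nil i
  | cons hs _ ih => exact ih.trans (.single hs.symm)

theorem exists_hubAdj (h0 : P 0) (hN : P N) {i : ℕ} (hi : i ≤ N + 1) :
    ∃ j, HubAdj N P i j := by
  rcases Nat.lt_trichotomy i N with h | h | h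
  · exact ⟨i + 1, .inl ⟨by omega, by omega, .inl rfl⟩⟩
  · subst h
    exact ⟨i + 1, .inr (.inr ⟨le_rfl, hN, rfl⟩)⟩
  · exact ⟨0, .inr (.inl ⟨by omega, by omega, h0⟩)⟩

/-- Going back and forth along an edge at the start adds 2 to the length. -/
theorem HubWalk.extend (h0 : P 0) (hN : P N) {l l' i j : ℕ} (hi : i ≤ N + 1)
    (h : HubWalk N P l i j) (hl : l ≤ l') (hp : l % 2 = l' % 2) : HubWalk N P l' i j := by
  obtain ⟨s, rfl⟩ : ∃ s, l' = l + 2 * s := ⟨(l' - l) / 2, by omega⟩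
  clear hl hp
  induction s with
  | zero => simpa using h
  | succ s ih =>
    obtain ⟨v, hv⟩ := exists_hubAdj h0 hN hi
    exact .cons hv (.cons hv.symm ih)

theorem HubWalk.path {i j : ℕ} (hij : i ≤ j) (hj : j ≤ N) : HubWalk N P (j - i) i j := by
  obtain ⟨d, rfl⟩ := Nat.exists_eq_add_of_le hij
  rw [Nat.add_sub_cancel_left]
  clear hij
  induction d with
  | zero => exact .nil i
  | succ d ih =>
    exact (ih (by omega)).trans (.single (.inl ⟨by omega, by omega, .inl (by omega)⟩))

theorem HubWalk.to_hub_right {i p l : ℕ} (hip : i ≤ p) (hp : p ≤ N) (hP : P p)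
    (hl : l = p - i + 1) : HubWalk N P l i (N + 1) := by
  subst hl
  exact (HubWalk.path hip hp).trans (.single (.inr (.inr ⟨hp, hP, rfl⟩)))

theorem HubWalk.to_hub_left {i p l : ℕ} (hip : p ≤ i) (hi : i ≤ N) (hP : P p)
    (hl : l = i - p + 1) : HubWalk N P l i (N + 1) := by
  subst hl
  exact (HubWalk.path hip hi).symm.trans (.single (.inr (.inr ⟨by omega, hP, rfl⟩)))

/-! ### Lower bounds for walks to the hub and for odd closed walks -/

/-- If odd differences of hub neighbours are at least `m`, then a walk to the hub is at least as
long as a walk that uses an odd cycle at most once. -/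
theorem HubWalk.length_bound {m : ℕ}
    (hm : ∀ p q, P p → P q → p < q → q ≤ N → (q - p) % 2 = 1 → m ≤ q - p)
    {l i j : ℕ} (h : HubWalk N P l i j) (hj : j = N + 1) :
    (i = N + 1 → l % 2 = 1 → m + 2 ≤ l) ∧
    (i ≤ N → ∃ p ≤ N, P p ∧
      ((i + 1 ≤ p + l ∧ p + 1 ≤ i + l ∧ (p + i + l) % 2 = 1) ∨
       (i + m + 3 ≤ p + l ∧ p + m + 3 ≤ i + l ∧ (p + i + l) % 2 = 0))) := by
  induction h with
  | nil i => exact ⟨by omega, by omega⟩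
  | @cons l i v k hs hw ih =>
    obtain ⟨ih1, ih2⟩ := ih hj
    rcases hs with ⟨hi, hv, hs⟩ | ⟨hi, hv, hP⟩ | ⟨hi, hP, hv⟩
    · refine ⟨by omega, fun _ => ?_⟩
      obtain ⟨p, hp, hPp, h⟩ := ih2 hv
      exact ⟨p, hp, hPp, by omega⟩
    · refine ⟨fun _ hl => ?_, by omega⟩
      obtain ⟨p, hp, hPp, h⟩ := ih2 hv
      -- If the rest of the walk is direct, parity makes p and v differ by an odd number, hence by
      -- at least m.
      rcases h with h | h
      · rcases Nat.lt_trichotomy p v with h' | h' | h'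
        · have := hm p v hPp hP h' hv (by omega)
          omega
        · omega
        · have := hm v p hP hPp h' hp (by omega)
          omega
      · omega
    · refine ⟨by omega, fun _ => ⟨i, hi, hP, ?_⟩⟩
      have := ih1 hv
      omega

/-- A walk that avoids the hub stays in the bipartite path, so its length has the parity of i + j.
-/
theorem HubWalk.split {l i j : ℕ} (h : HubWalk N P l i j) (hi : i ≤ N) (hj : j ≤ N) :
    (i + j + l) % 2 = 0 ∨
      ∃ a b, a + b = l ∧ HubWalk N P a i (N + 1) ∧ HubWalk N P b (N + 1) j := by
  induction h with
  | nil i => left; omega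
  | @cons l i v k hs hw ih =>
    by_cases hv : v ≤ N
    · rcases ih hv hj with h | ⟨a, b, hab, ha, hb⟩
      · left
        unfold HubAdj at hs
        omega
      · exact .inr ⟨a + 1, b, by omega, .cons hs ha, hb⟩
    · have hv' : v = N + 1 := by
        have := hs.symm.left_le
        omega
      subst hv'
      exact .inr ⟨1, l, by omega, .single hs, hw⟩

/-- `p < q` are consecutive hub neighbours. -/
def IsGap (N : ℕ) (P : ℕ → Prop) (p q : ℕ) : Prop :=
  p < q ∧ q ≤ N ∧ P p ∧ P q ∧ ∀ t, p < t → t < q → ¬ P t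

theorem IsGap.le_or_le {p q t : ℕ} (h : IsGap N P p q) (ht : P t) : t ≤ p ∨ q ≤ t := by
  by_contra! hc
  exact h.2.2.2.2 t hc.1 hc.2 ht

theorem exists_closed_walk_split {l u : ℕ} (hu : u ≤ N) (hl : l % 2 = 1)
    (h : HubWalk N P l u u) :
    ∃ a b, a + b = l ∧ HubWalk N P a u (N + 1) ∧ HubWalk N P b u (N + 1) := by
  rcases h.split hu hu with h | ⟨a, b, hab, ha, hb⟩
  · omega
  · exact ⟨a, b, hab, ha, hb.symm⟩

theorem IsGap.closed_walk_odd {p q l : ℕ} (h : IsGap N P p q) (hpq : (q - p) % 2 = 1)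
    (hl : l % 2 = 1) (hw : HubWalk N P l ((p + q) / 2) ((p + q) / 2)) : q - p + 2 ≤ l := by
  have hlt := h.1
  have hqN := h.2.1
  obtain ⟨a, b, hab, ha, hb⟩ := exists_closed_walk_split (by omega) hl hw
  -- Only distances matter here, and m = 0 makes the minimality hypothesis trivial. The two halves
  -- give l ≥ q - p + 1, and parity adds one more.
  have key : ∀ c, HubWalk N P c ((p + q) / 2) (N + 1) → q - p + 1 ≤ 2 * c := by
    intro c hc
    obtain ⟨r, hr, hPr, h'⟩ :=
      (hc.length_bound (m := 0) (by omega) rfl).2 (by omega)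
    have := h.le_or_le hPr
    omega
  have := key a ha
  have := key b hb
  omega

theorem IsGap.closed_walk_even {m p q l ε : ℕ} (h : IsGap N P p q) (hpq : (q - p) % 2 = 0)
    (hmo : m % 2 = 1)
    (hm : ∀ p q, P p → P q → p < q → q ≤ N → (q - p) % 2 = 1 → m ≤ q - p)
    (hε : ε = 0 ∨ (ε = 2 ∧ (m ≤ p → ¬ P (p - m)) ∧ (q + m ≤ N → ¬ P (q + m))))
    (hl : l % 2 = 1) (hw : HubWalk N P l ((p + q) / 2) ((p + q) / 2)) :
    q - p + m + 2 + ε ≤ l := by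
  obtain ⟨hlt, hqN, hPp, hPq, -⟩ := id h
  obtain ⟨a, b, hab, ha, hb⟩ := exists_closed_walk_split (by omega) hl hw
  -- Exactly one of the two halves has the parity that a direct walk to p or q cannot have. It
  -- either reaches a hub neighbour at odd distance beyond p or q, or contains an odd cycle. That
  -- distance is at least m, hence at least m + 2 if m itself is excluded (ε = 2).
  have key : ∀ c, HubWalk N P c ((p + q) / 2) (N + 1) → q - p + 2 ≤ 2 * c ∧
      (((p + q) / 2 + p + c) % 2 = 0 → q - p + 2 + 2 * m + 2 * ε ≤ 2 * c) := by
    intro c hc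
    obtain ⟨r, hr, hPr, h'⟩ := (hc.length_bound hm rfl).2 (by omega)
    have hor := h.le_or_le hPr
    refine ⟨by omega, fun hpar => ?_⟩
    rcases h' with h' | h'
    · rcases hor with hor | hor
      · have h1 := hm r p hPr hPp (by omega) (by omega) (by omega)
        have h2 : ε = 0 ∨ (ε = 2 ∧ p - r ≠ m) := by
          rcases hε with hε | ⟨hε, hε1, -⟩
          · exact .inl hε
          · refine .inr ⟨hε, fun he => hε1 (by omega) ?_⟩
            rwa [show p - m = r by omega]
        omega
      · have h1 := hm q r hPq hPr (by omega) (by omega) (by omega)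
        have h2 : ε = 0 ∨ (ε = 2 ∧ r - q ≠ m) := by
          rcases hε with hε | ⟨hε, -, hε1⟩
          · exact .inl hε
          · refine .inr ⟨hε, fun he => hε1 (by omega) ?_⟩
            rwa [show q + m = r by omega]
        omega
    · omega
  have ka := key a ha
  have kb := key b hb
  omega

/-! ### Upper bounds: walks to the hub of both parities -/

/-- The vertices `p ≤ u ≤ q`, where `p`, `q` are hub neighbours, have odd closed walks of length
at most `x + 1`. -/
def SpanBound (N : ℕ) (P : ℕ → Prop) (m x p q : ℕ) : Prop :=
  P p ∧ P q ∧ q ≤ N ∧ (((q - p) % 2 = 1 ∧ q - p + 1 ≤ x) ∨ q - p + m + 3 ≤ x ∨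
    (q - p + m + 1 ≤ x ∧ ((m ≤ p ∧ P (p - m)) ∨ (q + m ≤ N ∧ P (q + m)))))

/-- Two walks from `u` to the hub, of even and odd length, of total length at most `x + 1`. -/
def HubPair (N : ℕ) (P : ℕ → Prop) (x u : ℕ) : Prop :=
  ∃ a b, a + b ≤ x + 1 ∧ a % 2 = 0 ∧ b % 2 = 1 ∧ HubWalk N P a u (N + 1) ∧
    HubWalk N P b u (N + 1)

theorem hubPair_of_walks {x u a b : ℕ} (hab : a + b ≤ x + 1) (hp : (a + b) % 2 = 1)
    (ha : HubWalk N P a u (N + 1)) (hb : HubWalk N P b u (N + 1)) : HubPair N P x u := by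
  rcases Nat.mod_two_eq_zero_or_one a with h | h
  · exact ⟨a, b, hab, h, by omega, ha, hb⟩
  · exact ⟨b, a, by omega, by omega, h, hb, ha⟩

theorem hubWalk_hub {m s l : ℕ} (hs : s + m ≤ N) (hPs : P s) (hPm : P (s + m))
    (hl : l = m + 2) : HubWalk N P l (N + 1) (N + 1) := by
  subst hl
  exact .cons (.inr (.inl ⟨rfl, by omega, hPs⟩))
    (HubWalk.to_hub_right (Nat.le_add_right s m) hs hPm (by omega))

theorem SpanBound.hubPair {m x p q s u : ℕ} (h : SpanBound N P m x p q) (hmo : m % 2 = 1)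
    (hs : s + m ≤ N) (hPs : P s) (hPm : P (s + m)) (hpu : p ≤ u) (huq : u ≤ q) :
    HubPair N P x u := by
  obtain ⟨hPp, hPq, hqN, h | h | ⟨h, h'⟩⟩ := h
  · exact hubPair_of_walks (a := u - p + 1) (b := q - u + 1) (by omega) (by omega)
      (.to_hub_left hpu (by omega) hPp rfl) (.to_hub_right huq hqN hPq rfl)
  · have hh := hubWalk_hub hs hPs hPm rfl
    by_cases hc : u - p ≤ q - u
    · have w : HubWalk N P (u - p + 1) u (N + 1) := .to_hub_left hpu (by omega) hPp rfl
      exact hubPair_of_walks (by omega) (by omega) w (w.trans hh)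
    · have w : HubWalk N P (q - u + 1) u (N + 1) := .to_hub_right huq (by omega) hPq rfl
      exact hubPair_of_walks (by omega) (by omega) w (w.trans hh)
  · have hh := hubWalk_hub hs hPs hPm rfl
    rcases h' with ⟨h1, h2⟩ | ⟨h1, h2⟩
    · by_cases hc : u - p ≤ q - u
      · exact hubPair_of_walks (a := u - p + 1) (b := u - (p - m) + 1) (by omega) (by omega)
          (.to_hub_left hpu (by omega) hPp rfl) (.to_hub_left (by omega) (by omega) h2 rfl)
      · have w : HubWalk N P (q - u + 1) u (N + 1) := .to_hub_right huq (by omega) hPq rfl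
        -- Here q - p is odd and a detour through the odd cycle would be too long, but the direct
        -- walks to p and q already have opposite parities.
        by_cases hc2 : u - p = q - u + 1
        · exact hubPair_of_walks (a := u - p + 1) (b := q - u + 1) (by omega) (by omega)
            (.to_hub_left hpu (by omega) hPp rfl) w
        · exact hubPair_of_walks (by omega) (by omega) w (w.trans hh)
    · by_cases hc : q - u ≤ u - p
      · exact hubPair_of_walks (a := q - u + 1) (b := (q + m) - u + 1) (by omega) (by omega)
          (.to_hub_right huq (by omega) hPq rfl) (.to_hub_right (by omega) (by omega) h2 rfl)
      · have w : HubWalk N P (u - p + 1) u (N + 1) := .to_hub_left hpu (by omega) hPp rfl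
        by_cases hc2 : q - u = u - p + 1
        · exact hubPair_of_walks (a := q - u + 1) (b := u - p + 1) (by omega) (by omega)
            (.to_hub_right huq hqN hPq rfl) w
        · exact hubPair_of_walks (by omega) (by omega) w (w.trans hh)

/-! ### From walks to the exponent of the matrix -/

/-- The positive entries of `A` are the edges of the hub graph. -/
def IsHubMatrix (N : ℕ) (P : ℕ → Prop) (A : Matrix (Fin (N + 2)) (Fin (N + 2)) ℝ) : Prop :=
  (∀ i j, 0 ≤ A i j) ∧ ∀ i j : Fin (N + 2), 0 < A i j ↔ HubAdj N P i j

theorem IsHubMatrix.pow_pos_iff {A : Matrix (Fin (N + 2)) (Fin (N + 2)) ℝ}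
    (hA : IsHubMatrix N P A) (l : ℕ) (i j : Fin (N + 2)) :
    0 < (A ^ l) i j ↔ HubWalk N P l i j := by
  have hnn : ∀ l i j, 0 ≤ (A ^ l) i j := by
    intro l
    induction l with
    | zero =>
      intro i j
      rw [pow_zero, Matrix.one_apply]
      split_ifs <;> norm_num
    | succ l ih =>
      intro i j
      rw [pow_succ', Matrix.mul_apply]
      exact Finset.sum_nonneg fun v _ => mul_nonneg (hA.1 _ _) (ih _ _)
  induction l generalizing i with
  | zero =>
    rw [pow_zero, Matrix.one_apply]
    constructor
    · intro h
      split_ifs at h with hij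
      · subst hij
        exact .nil _
      · exact absurd h (lt_irrefl _)
    · intro h
      generalize hi' : (i : ℕ) = i' at h
      generalize hj' : (j : ℕ) = j' at h
      cases h
      rw [if_pos (Fin.ext (by omega))]
      norm_num
  | succ l ih =>
    rw [pow_succ', Matrix.mul_apply]
    constructor
    · intro h
      obtain ⟨v, -, hv⟩ := Finset.exists_ne_zero_of_sum_ne_zero h.ne'
      have h1 := left_ne_zero_of_mul hv
      have h2 := right_ne_zero_of_mul hv
      exact .cons ((hA.2 i v).1 (lt_of_le_of_ne (hA.1 _ _) h1.symm))
        ((ih v).1 (lt_of_le_of_ne (hnn _ _ _) h2.symm))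
    · intro h
      generalize hi' : (i : ℕ) = i' at h
      generalize hj' : (j : ℕ) = j' at h
      cases h with
      | @cons _ _ v _ hs hw =>
        have hv : v < N + 2 := by
          have := hs.symm.left_le
          omega
        subst hi' hj'
        refine Finset.sum_pos' (fun v _ => mul_nonneg (hA.1 _ _) (hnn _ _ _))
          ⟨⟨v, hv⟩, Finset.mem_univ _, mul_pos ((hA.2 _ _).2 hs) ((ih ⟨v, hv⟩).2 hw)⟩

/-- The even-even and odd-odd concatenations have total length at most 2x + 2. All lengths being
even, if one exceeds x it is at least x + 2, so the other is at most x. -/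
theorem hubWalk_of_hubPair (h0 : P 0) (hN : P N) {x i j : ℕ} (hx : x % 2 = 0)
    (hi : i ≤ N + 1) (h : HubPair N P x i) (h' : HubPair N P x j) : HubWalk N P x i j := by
  obtain ⟨a, b, hab, ha2, hb2, ha, hb⟩ := h
  obtain ⟨a', b', hab', ha2', hb2', ha', hb'⟩ := h'
  by_cases hc : a + a' ≤ x
  · exact (ha.trans ha'.symm).extend h0 hN hi hc (by omega)
  · exact (hb.trans hb'.symm).extend h0 hN hi (by omega) (by omega)

theorem IsHubMatrix.exponent_eq {A : Matrix (Fin (N + 2)) (Fin (N + 2)) ℝ}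
    (hA : IsHubMatrix N P A) (h0 : P 0) (hN : P N) {x : ℕ} (hx : x % 2 = 0) (hx0 : 0 < x)
    (hpair : ∀ u ≤ N + 1, HubPair N P x u) {u : ℕ} (hu : u ≤ N)
    (hlow : ∀ l, l % 2 = 1 → HubWalk N P l u u → x + 1 ≤ l) :
    A.IsPrimitive ∧ exponent A = x := by
  have hmem : x ∈ {m : ℕ | 0 < m ∧ ∀ i j, 0 < (A ^ m) i j} := by
    refine ⟨hx0, fun i j => (hA.pow_pos_iff x i j).2 ?_⟩
    exact hubWalk_of_hubPair h0 hN hx (by omega) (hpair _ (by omega)) (hpair _ (by omega))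
  refine ⟨⟨hA.1, x, hmem.1, hmem.2⟩, le_antisymm (Nat.sInf_le hmem) ?_⟩
  refine le_csInf ⟨x, hmem⟩ ?_
  rintro y ⟨hy0, hy⟩
  by_contra! hyx
  have hall : ∀ i j, i ≤ N + 1 → j ≤ N + 1 → HubWalk N P y i j := fun i j hi hj =>
    (hA.pow_pos_iff y ⟨i, by omega⟩ ⟨j, by omega⟩).1 (hy _ _)
  -- An even y also yields an odd closed walk at u, of length y + 1, by prepending an edge.
  rcases Nat.mod_two_eq_zero_or_one y with hy2 | hy2
  · obtain ⟨v, hv⟩ := exists_hubAdj h0 hN (show u ≤ N + 1 by omega)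
    have := hlow _ (by omega) (HubWalk.cons hv (hall v u hv.symm.left_le (by omega)))
    omega
  · have := hlow _ hy2 (hall u u (by omega) (by omega))
    omega


/-! ### Gaps, and the dictionary between matrices and gap configurations -/

theorem exists_gap_around (h0 : P 0) (hN : P N) {u : ℕ} (hu : u < N) :
    ∃ p q, IsGap N P p q ∧ p ≤ u ∧ u < q := by
  classical
  have hex : ∃ q, u < q ∧ P q := ⟨N, hu, hN⟩
  have hp := Nat.findGreatest_spec (P := P) (Nat.zero_le u) h0
  have hple := Nat.findGreatest_le (P := P) u
  obtain ⟨hq1, hq2⟩ := Nat.find_spec hex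
  refine ⟨Nat.findGreatest P u, Nat.find hex, ⟨by omega, Nat.find_min' hex ⟨hu, hN⟩, hp, hq2, ?_⟩,
    hple, hq1⟩
  intro t ht1 ht2 hPt
  by_cases htu : t ≤ u
  · exact Nat.findGreatest_is_greatest ht1 htu hPt
  · exact Nat.find_min hex ht2 ⟨by omega, hPt⟩

/-- Cutting an odd interval at a hub neighbour leaves one odd part. Hence the shortest odd
difference of hub neighbours is also the shortest odd gap. -/
theorem exists_odd_gap {p q : ℕ} (hp : P p) (hq : P q) (hqN : q ≤ N) (hpq : p < q)
    (h : (q - p) % 2 = 1) :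
    ∃ p' q', IsGap N P p' q' ∧ p ≤ p' ∧ q' ≤ q ∧ (q' - p') % 2 = 1 := by
  induction hd : q - p using Nat.strong_induction_on generalizing p q with
  | _ d ih =>
    by_cases hg : ∃ t, p < t ∧ t < q ∧ P t
    · obtain ⟨t, h1, h2, ht⟩ := hg
      rcases Nat.mod_two_eq_zero_or_one (t - p) with h' | h'
      · obtain ⟨p', q', hgap, h3, h4, h5⟩ :=
          ih (q - t) (by omega) ht hq hqN h2 (by omega) rfl
        exact ⟨p', q', hgap, by omega, h4, h5⟩
      · obtain ⟨p', q', hgap, h3, h4, h5⟩ :=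
          ih (t - p) (by omega) hp ht (by omega) h1 h' rfl
        exact ⟨p', q', hgap, h3, by omega, h5⟩
    · push Not at hg
      exact ⟨p, q, ⟨hpq, hqN, hp, hq, hg⟩, le_rfl, le_rfl, h⟩

/-- The hub neighbours include both ends of the path, and the longest gap between consecutive
ones has length `K`. -/
structure GapConfig (N K : ℕ) (P : ℕ → Prop) : Prop where
  zero : P 0
  last : P N
  longest : ∃ a, IsGap N P a (a + K)
  le : ∀ p q, IsGap N P p q → q - p ≤ K

theorem isHubMatrix_companion {a : Fin (N + 2) → ℝ} (ha : ∀ i, a i = 0 ∨ a i = 1)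
    (hlast : ∀ i : Fin (N + 2), (i : ℕ) = N + 1 → a i = 0) (hPN : P N)
    (hP : ∀ i : Fin (N + 2), (i : ℕ) < N → (P i ↔ a i = 1)) :
    IsHubMatrix N P (companion a + (companion a)ᵀ) := by
  have hnn : ∀ j, 0 ≤ a j := fun j => by
    rcases ha j with h | h <;> simp [h]
  have hPa : ∀ i : Fin (N + 2), (i : ℕ) < N → (P i ↔ 0 < a i) := by
    intro i hi
    rw [hP i hi]
    rcases ha i with h | h <;> rw [h] <;> norm_num
  have hmat : ∀ i j : Fin (N + 2), (companion a + (companion a)ᵀ) i j =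
      (if (i : ℕ) = N + 1 then a j else if (j : ℕ) = i + 1 then 1 else 0) +
      (if (j : ℕ) = N + 1 then a i else if (i : ℕ) = j + 1 then 1 else 0) := by
    intro i j
    simp only [companion, Matrix.add_apply, Matrix.transpose_apply, Matrix.of_apply,
      show ∀ i : ℕ, i + 1 = N + 2 ↔ i = N + 1 by omega]
  refine ⟨fun i j => ?_, fun i j => ?_⟩
  · rw [hmat]
    apply add_nonneg <;> split_ifs <;> simp [hnn]
  have hil := i.isLt
  have hjl := j.isLt
  rw [hmat]
  unfold HubAdj
  by_cases hi : (i : ℕ) = N + 1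
  · rw [if_pos hi]
    by_cases hj : (j : ℕ) = N + 1
    · rw [if_pos hj, hlast i hi, hlast j hj]
      exact iff_of_false (by norm_num) (by omega)
    · rw [if_neg hj]
      by_cases hjN : (j : ℕ) = N
      · rw [if_pos (by omega), hjN]
        exact iff_of_true (by linarith [hnn j]) (.inr (.inl ⟨hi, le_rfl, hPN⟩))
      · rw [if_neg (by omega), add_zero, ← hPa j (by omega)]
        refine ⟨fun h => .inr (.inl ⟨hi, by omega, h⟩), ?_⟩
        rintro (h | h | h)
        · omega
        · exact h.2.2
        · omega
  · rw [if_neg hi]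
    by_cases hj : (j : ℕ) = N + 1
    · rw [if_pos hj]
      by_cases hiN : (i : ℕ) = N
      · rw [if_pos (by omega), hiN]
        exact iff_of_true (by linarith [hnn i]) (.inr (.inr ⟨le_rfl, hPN, hj⟩))
      · rw [if_neg (show ¬ (j : ℕ) = i + 1 by omega), zero_add, ← hPa i (by omega)]
        refine ⟨fun h => .inr (.inr ⟨by omega, h, hj⟩), ?_⟩
        rintro (h | h | h)
        · omega
        · omega
        · exact h.2.1
    · rw [if_neg hj]
      split_ifs <;> norm_num <;> omega

theorem exists_gapConfig {k : ℕ} (hN : 3 ≤ N) {A : Matrix (Fin (N + 2)) (Fin (N + 2)) ℝ}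
    (hA : A ∈ pscRun (N + 2) k) :
    ∃ P, GapConfig N (k + 1) P ∧ IsHubMatrix N P A := by
  obtain ⟨⟨⟨C, ⟨a, ha, rfl⟩, hα, he, rfl⟩, hprim⟩, q, Y, ⟨-, hk1, hk2⟩, hY⟩ := hA
  have a0 : a ⟨0, by omega⟩ = 1 := by
    have := hα ⟨N + 1, by omega⟩ ⟨0, by omega⟩ rfl rfl
    simpa [companion] using this
  have alast : a ⟨N + 1, by omega⟩ = 0 := by
    have := he ⟨N + 1, by omega⟩ rfl
    simpa [companion] using this
  -- The superdiagonal of A already joins N to the hub, so N is a hub neighbour whatever a takes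
  -- there (c = 1 or c = 2).
  set P : ℕ → Prop := fun t => t = N ∨ ∃ h : t < N + 2, a ⟨t, h⟩ = 1 with hP
  have hYP : ∀ t : Fin (N + 2 - 3), Y t = 0 ↔ ¬ P (t + 1) := by
    intro t
    have ht := t.isLt
    have h1 := hY ⟨N + 1, by omega⟩ ⟨t + 1, by omega⟩ t rfl rfl
    have h2 : a ⟨t + 1, by omega⟩ = ((Y t : ℕ) : ℝ) := by
      rw [← h1]
      simp only [companion, Matrix.add_apply, Matrix.transpose_apply, Matrix.of_apply]
      rw [if_pos trivial, if_neg (by omega), if_neg (by omega), add_zero]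
    have h3 : P (t + 1) ↔ a ⟨t + 1, by omega⟩ = 1 := by
      constructor
      · rintro (h | ⟨_, h⟩)
        · omega
        · exact h
      · exact fun h => .inr ⟨by omega, h⟩
    rw [h3, h2]
    have h4 : Y t = 0 ∨ Y t = 1 := by omega
    rcases h4 with h4 | h4 <;> simp [h4]
  have P0 : P 0 := .inr ⟨by omega, a0⟩
  have PN : P N := .inl rfl
  have hle : ∀ p q, IsGap N P p q → q - p ≤ k + 1 := by
    intro p q hg
    have h1 := hg.1
    have h2 := hg.2.1
    by_cases h3 : q = p + 1
    · omega
    · have := hk2 (a := q - p - 1) ⟨p, by omega, fun t ht1 ht2 =>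
        (hYP t).2 (hg.2.2.2.2 _ (by omega) (by omega))⟩
      omega
  refine ⟨P, ⟨P0, PN, ?_, hle⟩, ?_⟩
  · obtain ⟨s, hs, hz⟩ := hk1
    obtain ⟨p, q, hg, hp, hq⟩ := exists_gap_around P0 PN (show s < N by omega)
    have hq2 : s + k < q := by
      by_contra! hc
      have h1 := hg.1
      exact (hYP ⟨q - 1, by omega⟩).1 (hz ⟨q - 1, by omega⟩ (by simp; omega) (by simp; omega))
        (by simpa [show q - 1 + 1 = q by omega] using hg.2.2.2.1)
    have := hle p q hg
    refine ⟨p, ?_⟩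
    rwa [show p + (k + 1) = q by omega]
  · refine isHubMatrix_companion ha (fun i hi => ?_) PN (fun i hi => ?_)
    · rw [← alast]
      exact congrArg a (Fin.ext hi)
    · constructor
      · rintro (h | ⟨_, h⟩)
        · omega
        · exact h
      · exact fun h => .inr ⟨i.isLt, h⟩

theorem GapConfig.exists_matrix {k : ℕ} (hN : 3 ≤ N) (hP : GapConfig N (k + 1) P) :
    ∃ A, IsHubMatrix N P A ∧ (A.IsPrimitive → A ∈ pscRun (N + 2) k) := by
  classical
  -- Entry N is set to 0, so c = 1; the choice c = 2 would give the same graph.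
  set a : Fin (N + 2) → ℝ := fun i => if (i : ℕ) < N ∧ P i then 1 else 0 with ha
  have ha01 : ∀ i, a i = 0 ∨ a i = 1 := by
    intro i
    by_cases h : (i : ℕ) < N ∧ P i
    · exact .inr (if_pos h)
    · exact .inl (if_neg h)
  refine ⟨companion a + (companion a)ᵀ, isHubMatrix_companion ha01
    (fun i hi => if_neg (by omega)) hP.last (fun i hi => ?_),
    fun hprim => ⟨⟨⟨companion a, ⟨a, ha01, rfl⟩, ?_, ?_, rfl⟩, hprim⟩,
      _, fun t => if P (t + 1) then 1 else 0, ⟨rfl, ?_, ?_⟩, ?_⟩⟩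
  · simp [ha, hi]
  · intro i j hi hj
    simp only [companion, Matrix.of_apply, ha]
    rw [if_pos hi, if_pos ⟨by omega, by rw [hj]; exact hP.zero⟩]
  · intro i hi
    simp only [companion, Matrix.of_apply, ha]
    rw [if_pos hi, if_neg (by omega)]
  · obtain ⟨s, h1, h2, -, -, h3⟩ := hP.longest
    exact ⟨s, by omega, fun t ht1 ht2 => if_neg (h3 _ (by omega) (by omega))⟩
  · rintro l ⟨s, hs, hz⟩
    obtain ⟨p, q, hg, hp, hq⟩ := exists_gap_around hP.zero hP.last (show s < N by omega)
    have hq2 : s + l < q := by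
      by_contra! hc
      have h1 := hg.1
      have h2 := hz ⟨q - 1, by have := hg.2.1; omega⟩ (by simp; omega) (by simp; omega)
      simp only [show q - 1 + 1 = q by omega, if_pos hg.2.2.2.1] at h2
      exact absurd h2 (by decide)
    have := hP.le p q hg
    omega
  · intro i j t hi hj
    have ht := t.isLt
    have haj : a j = if P (t + 1) then 1 else 0 := by
      simp only [ha, hj]
      by_cases hPt : P (t + 1)
      · rw [if_pos ⟨by omega, hPt⟩, if_pos hPt]
      · rw [if_neg (fun h => hPt h.2), if_neg hPt]
    simp only [companion, Matrix.add_apply, Matrix.transpose_apply, Matrix.of_apply]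
    rw [if_pos hi, if_neg (show ¬ (j : ℕ) + 1 = N + 2 by omega),
      if_neg (show ¬ (i : ℕ) = j + 1 by omega), add_zero, haj]
    split_ifs <;> simp

/-! ### The exponent as the largest gap cost -/

/-- The length that the gap `p < q` requires of the exponent, given the shortest odd gap `m`. -/
def GapCost (N : ℕ) (P : ℕ → Prop) (m p q c : ℕ) : Prop :=
  ((q - p) % 2 = 1 ∧ c = q - p + 1) ∨
  ((q - p) % 2 = 0 ∧ c = q - p + m + 1 ∧
    ((m ≤ p ∧ P (p - m)) ∨ (q + m ≤ N ∧ P (q + m)))) ∨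
  ((q - p) % 2 = 0 ∧ c = q - p + m + 3 ∧
    (m ≤ p → ¬ P (p - m)) ∧ (q + m ≤ N → ¬ P (q + m)))

theorem exists_gapCost (N : ℕ) (P : ℕ → Prop) (m p q : ℕ) : ∃ c, GapCost N P m p q c := by
  unfold GapCost
  rcases Nat.mod_two_eq_zero_or_one (q - p) with h | h
  · by_cases h' : (m ≤ p ∧ P (p - m)) ∨ (q + m ≤ N ∧ P (q + m))
    · exact ⟨_, .inr (.inl ⟨h, rfl, h'⟩)⟩
    · push Not at h'
      exact ⟨_, .inr (.inr ⟨h, rfl, h'⟩)⟩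
  · exact ⟨_, .inl ⟨h, rfl⟩⟩

/-- `m` is the length of the shortest odd gap. -/
def IsShortestOdd (N : ℕ) (P : ℕ → Prop) (m : ℕ) : Prop :=
  m % 2 = 1 ∧ (∃ e, e + m ≤ N ∧ P e ∧ P (e + m)) ∧
    ∀ p q, P p → P q → p < q → q ≤ N → (q - p) % 2 = 1 → m ≤ q - p

theorem IsHubMatrix.exponent_eq_gapCost {A : Matrix (Fin (N + 2)) (Fin (N + 2)) ℝ}
    (hA : IsHubMatrix N P A) (h0 : P 0) (hN : P N) {m x p q : ℕ} (hm : IsShortestOdd N P m)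
    (hcover : ∀ u < N, ∃ p q, p ≤ u ∧ u < q ∧ SpanBound N P m x p q)
    (hg : IsGap N P p q) (hx : GapCost N P m p q x) : A.IsPrimitive ∧ exponent A = x := by
  obtain ⟨hmo, ⟨e, he, hPe, hPm⟩, hmin⟩ := hm
  have hgap := id hg
  obtain ⟨h1, h2, -⟩ := hgap
  have hmx : m + 1 ≤ x := by
    have := hmin p q hg.2.2.1 hg.2.2.2.1 h1 h2
    unfold GapCost at hx
    omega
  refine hA.exponent_eq h0 hN ?_ (by omega) ?_ (u := (p + q) / 2) (by omega) ?_
  · unfold GapCost at hx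
    omega
  · intro u hu
    rcases Nat.lt_trichotomy u N with h | h | h
    · obtain ⟨p, q, hp, hq, hs⟩ := hcover u h
      exact hs.hubPair hmo he hPe hPm hp hq.le
    · obtain ⟨p, q, hp, hq, hs⟩ := hcover (N - 1) (by omega)
      exact hs.hubPair hmo he hPe hPm (by omega) (by omega)
    · obtain rfl : u = N + 1 := by omega
      exact hubPair_of_walks (a := 0) (b := m + 2) (by omega) (by omega) (.nil _)
        (hubWalk_hub he hPe hPm rfl)
  · intro l hl hw
    rcases hx with ⟨h3, rfl⟩ | ⟨h3, rfl, -⟩ | ⟨h3, rfl, h4⟩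
    · exact hg.closed_walk_odd h3 hl hw
    · exact hg.closed_walk_even (ε := 0) h3 hmo hmin (.inl rfl) hl hw
    · exact hg.closed_walk_even (ε := 2) h3 hmo hmin (.inr ⟨rfl, h4⟩) hl hw

/-- All constructions go through this criterion. The covering spans need not be gaps; since each gap
lies inside a span, their length bound also shows that no gap exceeds k + 1. -/
theorem mem_exponentSet_pscRun {k m x a p q : ℕ} (hN : 3 ≤ N) (h0 : P 0) (hPN : P N)
    (ha : IsGap N P a (a + (k + 1))) (hm : IsShortestOdd N P m)
    (hcover : ∀ u < N, ∃ p q, p ≤ u ∧ u < q ∧ q ≤ p + k + 1 ∧ SpanBound N P m x p q)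
    (hg : IsGap N P p q) (hx : GapCost N P m p q x) :
    x ∈ exponentSet (pscRun (N + 2) k) := by
  have hP : GapConfig N (k + 1) P := by
    refine ⟨h0, hPN, ⟨a, ha⟩, fun p q hg => ?_⟩
    have h1 := hg.1
    have h2 := hg.2.1
    obtain ⟨r, s, hr, hs, hrs, hPr, hPs, -⟩ := hcover p (by omega)
    have := hg.le_or_le hPr
    have := hg.le_or_le hPs
    omega
  obtain ⟨A, hA, hA'⟩ := hP.exists_matrix hN
  obtain ⟨h1, h2⟩ := hA.exponent_eq_gapCost h0 hPN hm
    (fun u hu => by obtain ⟨p, q, hp, hq, -, h⟩ := hcover u hu; exact ⟨p, q, hp, hq, h⟩) hg hx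
  exact ⟨A, hA' h1, h1, h2⟩

/-- The data of a configuration with exponent `x`. -/
structure Profile (N K : ℕ) (P : ℕ → Prop) (m x c d : ℕ) : Prop extends GapConfig N K P where
  shortest : IsShortestOdd N P m
  gap : IsGap N P c d
  cost : GapCost N P m c d x
  cost_le : ∀ p q y, IsGap N P p q → GapCost N P m p q y → y ≤ x

theorem exists_profile {k x : ℕ} (hN : 3 ≤ N) (hx : x ∈ exponentSet (pscRun (N + 2) k)) :
    ∃ P m c d, Profile N (k + 1) P m x c d := by
  classical
  obtain ⟨A, hA, hprim, rfl⟩ := hx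
  obtain ⟨P, hP, hH⟩ := exists_gapConfig hN hA
  have hodd : ∃ m, ∃ p q, IsGap N P p q ∧ (q - p) % 2 = 1 ∧ m = q - p := by
    by_contra! hc
    -- Without odd gaps every m satisfies the minimality hypothesis. Taking m equal to the length of
    -- an odd closed walk at the hub contradicts `HubWalk.length_bound`.
    have hc' : ∀ m p q, P p → P q → p < q → q ≤ N → (q - p) % 2 = 1 → m ≤ q - p := by
      intro m p q hp hq hpq hqN h
      obtain ⟨p', q', hg, -, -, h'⟩ := exists_odd_gap hp hq hqN hpq h
      exact absurd rfl (hc _ p' q' hg h')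
    obtain ⟨l, hl0, hl⟩ := hprim.2
    have hw := fun i j hi hj => (hH.pow_pos_iff l ⟨i, hi⟩ ⟨j, hj⟩).1 (hl _ _)
    rcases Nat.mod_two_eq_zero_or_one l with h | h
    · have := (HubWalk.length_bound (hc' (l + 1)) (HubWalk.cons
        (.inr (.inl ⟨rfl, Nat.zero_le _, hP.zero⟩)) (hw 0 (N + 1) (by omega) (by omega)))
        rfl).1 rfl (by omega)
      omega
    · have := (HubWalk.length_bound (hc' l) (hw (N + 1) (N + 1) (by omega) (by omega))
        rfl).1 rfl h
      omega
  obtain ⟨e, f, hef, hm2, hm3⟩ := Nat.find_spec hodd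
  set m := Nat.find hodd with hmdef
  have hm : IsShortestOdd N P m := by
    refine ⟨by omega, ⟨e, ?_⟩, ?_⟩
    · rw [show e + m = f by have := hef.1; omega]
      exact ⟨hef.2.1, hef.2.2.1, hef.2.2.2.1⟩
    · intro p q hp hq hpq hqN h
      obtain ⟨p', q', hg, h1, h2, h'⟩ := exists_odd_gap hp hq hqN hpq h
      have := Nat.find_min' hodd ⟨p', q', hg, h', rfl⟩
      have := hg.1
      omega
  set S : Set ℕ := {y | ∃ p q, IsGap N P p q ∧ GapCost N P m p q y} with hS
  have hne : S.Nonempty := by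
    obtain ⟨y, hy⟩ := exists_gapCost N P m e f
    exact ⟨y, e, f, hef, hy⟩
  have hbdd : BddAbove S := by
    refine ⟨N + m + 3, ?_⟩
    rintro y ⟨p, q, hg, hy⟩
    have := hg.2.1
    unfold GapCost at hy
    omega
  obtain ⟨c, d, hcd, hcost⟩ := Nat.sSup_mem hne hbdd
  have hle : ∀ p q y, IsGap N P p q → GapCost N P m p q y → y ≤ sSup S :=
    fun p q y hg hy => le_csSup hbdd ⟨p, q, hg, hy⟩
  have hex := hH.exponent_eq_gapCost hP.zero hP.last hm (x := sSup S) (fun u hu => by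
    obtain ⟨p, q, hg, hp, hq⟩ := exists_gap_around hP.zero hP.last hu
    obtain ⟨y, hy⟩ := exists_gapCost N P m p q
    have := hle p q y hg hy
    refine ⟨p, q, hp, hq, hg.2.2.1, hg.2.2.2.1, hg.2.1, ?_⟩
    rcases hy with ⟨h1, rfl⟩ | ⟨h1, rfl, h2⟩ | ⟨h1, rfl, -⟩
    · exact .inl ⟨h1, this⟩
    · exact .inr (.inr ⟨this, h2⟩)
    · exact .inr (.inl this)) hcd hcost
  rw [hex.2]
  exact ⟨P, m, c, d, hP, hm, hcd, hcost, hle⟩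


/-! ### Constraints on the exponent -/

variable {K m x c d : ℕ}

theorem IsGap.trichotomy {p q r s : ℕ} (h : IsGap N P p q) (h' : IsGap N P r s) :
    q ≤ r ∨ s ≤ p ∨ (p = r ∧ q = s) := by
  have h1 := h.1
  have h2 := h'.1
  have := h.le_or_le h'.2.2.1
  have := h.le_or_le h'.2.2.2.1
  have := h'.le_or_le h.2.2.1
  have := h'.le_or_le h.2.2.2.1
  omega

namespace Profile

theorem exists_longest (h : Profile N K P m x c d) : ∃ a b, IsGap N P a b ∧ b = a + K := by
  obtain ⟨a, ha⟩ := h.longest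
  exact ⟨a, a + K, ha, rfl⟩

theorem exists_shortest (h : Profile N K P m x c d) :
    ∃ e f, IsGap N P e f ∧ f = e + m ∧ m % 2 = 1 := by
  obtain ⟨hmo, ⟨e, he, h1, h2⟩, hm⟩ := h.shortest
  obtain ⟨p, q, hg, hp, hq, hpq⟩ := exists_odd_gap h1 h2 he (by omega) (by omega)
  have := hm p q hg.2.2.1 hg.2.2.2.1 hg.1 hg.2.1 hpq
  have := hg.1
  exact ⟨p, q, hg, by omega, hmo⟩

theorem le_odd (h : Profile N K P m x c d) {p q : ℕ} (hp : P p) (hq : P q) (hqN : q ≤ N) :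
    p < q → (q - p) % 2 = 1 → m ≤ q - p :=
  fun h1 h2 => h.shortest.2.2 p q hp hq h1 hqN h2

theorem even (h : Profile N K P m x c d) : x % 2 = 0 := by
  have hmo := h.shortest.1
  rcases h.cost with h | h | h <;> omega

theorem lower (h : Profile N K P m x c d) :
    (K % 2 = 1 → K + 1 ≤ x) ∧ (K % 2 = 0 → K + m + 1 ≤ x) ∧ m ≤ K := by
  obtain ⟨a, b, hab, rfl⟩ := h.exists_longest
  obtain ⟨e, f, hef, rfl, -⟩ := h.exists_shortest
  obtain ⟨y, hy⟩ := exists_gapCost N P m a (a + K)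
  have h1 := h.cost_le _ _ _ hab hy
  have h2 := h.le _ _ hef
  unfold GapCost at hy
  omega

/-- An even gap and m have opposite parities and are at most K, so their sum is at most 2K - 1, and
the cost adds at most 3. -/
theorem upper (h : Profile N K P m x c d) : x ≤ 2 * K + 2 := by
  have h1 := h.lower.2.2
  have h2 := h.le _ _ h.gap
  have h3 := h.shortest.1
  have h4 := h.cost
  unfold GapCost at h4
  omega

theorem cost_cases (h : Profile N K P m x c d) :
    ((d - c) % 2 = 1 ∧ x = d - c + 1) ∨
    ((d - c) % 2 = 0 ∧ x = d - c + m + 1) ∨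
    ((d - c) % 2 = 0 ∧ x = d - c + m + 3 ∧ ∀ t ≤ N, P t → t + m ≠ c ∧ t ≠ d + m) := by
  rcases h.cost with h' | h' | h'
  · exact .inl h'
  · exact .inr (.inl ⟨h'.1, h'.2.1⟩)
  · refine .inr (.inr ⟨h'.1, h'.2.1, fun t htN ht => ⟨?_, ?_⟩⟩)
    · rintro rfl
      exact h'.2.2.1 (by omega) (by simpa using ht)
    · rintro rfl
      exact h'.2.2.2 htN ht

/-- An even gap is disjoint from the shortest odd gap, and if it is isolated the two are at least 2
apart, which pays for the larger cost. -/
theorem le_length_add_one (h : Profile N K P m x c d) : x ≤ N + 1 := by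
  obtain ⟨e, f, hef, hf, hmo⟩ := h.exists_shortest
  obtain ⟨h1, h2, h3, h4, -⟩ := h.gap
  have h5 := h.gap.trichotomy hef
  obtain ⟨h6, h7, h8, h9, -⟩ := hef
  have := h.le_odd h9 h3 (by omega)
  have := h.le_odd h4 h8 (by omega)
  rcases h.cost_cases with hc | hc | ⟨hc1, hc2, hc⟩
  · omega
  · omega
  · have := hc e (by omega) h8
    have := hc f (by omega) h9
    omega

theorem exists_piece (h : Profile N K P m x c d) {p q : ℕ} (hp : P p) (hq : P q) (hqN : q ≤ N)
    (hpq : p ≤ q) : ∃ z, q = p + z ∧ (z % 2 = 0 ∨ m ≤ z) := by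
  refine ⟨q - p, by omega, ?_⟩
  by_cases h' : (q - p) % 2 = 1
  · exact .inr (h.le_odd hp hq hqN (by omega) h')
  · exact .inl (by omega)

/-- Bookkeeping for the parity counts: u, v, w are the parts of the path left by two gaps, with v
between them and w on the far side of r, s. The last clause applies when r, s is isolated. -/
theorem exists_pieces (h : Profile N K P m x c d) {a b r s : ℕ} (hab : IsGap N P a b)
    (hrs : IsGap N P r s) (hdis : b ≤ r ∨ s ≤ a) :
    ∃ u v w, u + v + w + (b - a) + (s - r) = N ∧ (u % 2 = 0 ∨ m ≤ u) ∧ (v % 2 = 0 ∨ m ≤ v) ∧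
      (w % 2 = 0 ∨ m ≤ w) ∧ ((∀ t ≤ N, P t → t + m ≠ r ∧ t ≠ s + m) →
        v ≠ m ∧ w ≠ m ∧ (v = 0 → b - a ≠ m)) := by
  obtain ⟨h1, h2, h3, h4, -⟩ := hab
  obtain ⟨h6, h7, h8, h9, -⟩ := hrs
  rcases hdis with hdis | hdis
  · obtain ⟨u, hu, hu'⟩ := h.exists_piece h.zero h3 (by omega) (Nat.zero_le _)
    obtain ⟨v, hv, hv'⟩ := h.exists_piece h4 h8 (by omega) hdis
    obtain ⟨w, hw, hw'⟩ := h.exists_piece h9 h.last le_rfl h7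
    refine ⟨u, v, w, by omega, hu', hv', hw', fun hc => ?_⟩
    have := hc a (by omega) h3
    have := hc b (by omega) h4
    have := hc N le_rfl h.last
    omega
  · obtain ⟨u, hu, hu'⟩ := h.exists_piece h.zero h8 (by omega) (Nat.zero_le _)
    obtain ⟨v, hv, hv'⟩ := h.exists_piece h9 h3 (by omega) hdis
    obtain ⟨w, hw, hw'⟩ := h.exists_piece h4 h.last le_rfl h2
    refine ⟨w, v, u, by omega, hw', hv', hu', fun hc => ?_⟩
    have := hc a (by omega) h3
    have := hc b (by omega) h4
    have := hc 0 (Nat.zero_le _) h.zero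
    omega

theorem exists_four_pieces (h : Profile N K P m x c d) {a b r s e f : ℕ} (hab : IsGap N P a b)
    (hrs : IsGap N P r s) (hef : IsGap N P e f) (hbr : b ≤ r) (hse : s ≤ e) :
    ∃ u v w z, u + v + w + z + (b - a) + (s - r) + (f - e) = N ∧ (u % 2 = 0 ∨ m ≤ u) ∧
      (v % 2 = 0 ∨ m ≤ v) ∧ (w % 2 = 0 ∨ m ≤ w) ∧ (z % 2 = 0 ∨ m ≤ z) := by
  obtain ⟨h1, h2, h3, h4, -⟩ := hab
  obtain ⟨h6, h7, h8, h9, -⟩ := hrs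
  obtain ⟨h11, h12, h13, h14, -⟩ := hef
  obtain ⟨u, hu, hu'⟩ := h.exists_piece h.zero h3 (by omega) (Nat.zero_le _)
  obtain ⟨v, hv, hv'⟩ := h.exists_piece h4 h8 (by omega) hbr
  obtain ⟨w, hw, hw'⟩ := h.exists_piece h9 h13 (by omega) hse
  obtain ⟨z, hz, hz'⟩ := h.exists_piece h14 h.last le_rfl h12
  exact ⟨u, v, w, z, by omega, hu', hv', hw', hz'⟩

/-- The gaps K (even) and m (odd) cannot fill an even N, so another odd piece of length at least m
is present. If the longest gap is isolated, two more steps are needed. -/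
theorem upper_even_even (h : Profile N K P m x c d) (hK : K % 2 = 0) (hN : N % 2 = 0) :
    (x ≤ K + m + 1 ∧ 2 * m + K ≤ N) ∨ (x = K + m + 3 ∧ 2 * m + K + 2 ≤ N) := by
  obtain ⟨e, f, hef, hf, hmo⟩ := h.exists_shortest
  have key : ∀ a b, IsGap N P a b → b = a + K → 2 * m + K ≤ N ∧
      ((∀ t ≤ N, P t → t + m ≠ a ∧ t ≠ b + m) → 2 * m + K + 2 ≤ N) := by
    intro a b hab hb
    have h0 := hef.trichotomy hab
    obtain ⟨u, v, w, hs, hu, hv, hw, hc⟩ := h.exists_pieces hef hab (by omega)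
    rw [show f - e = m by omega, show b - a = K by omega] at hs
    refine ⟨by omega, fun h' => ?_⟩
    have := hc h'
    omega
  obtain ⟨a, b, hab, hb⟩ := h.exists_longest
  have hle := h.le _ _ h.gap
  have h1 := (key a b hab hb).1
  rcases h.cost_cases with hc | hc | ⟨hc1, hc2, hc⟩
  · omega
  · omega
  · by_cases hK' : d - c = K
    · have h2 := h.gap.1
      have := (key c d h.gap (by omega)).2 hc
      omega
    · omega

/-- Unless x = K + 1, the cost is attained by an even gap, disjoint from the odd gap K. As N is
even, an odd piece of length at least m remains, so (d - c) + K + m ≤ N. In the boundary case N = 3K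
- 1, equality forces m = K and puts a hub neighbour at distance m from the even gap, which is then
not isolated. -/
theorem upper_even_odd (h : Profile N K P m x c d) (hK : K % 2 = 1) (hN : N % 2 = 0) :
    x = K + 1 ∨ (x + K ≤ N + 3 ∧ (N + 1 = 3 * K → x ≠ 2 * K + 2)) := by
  obtain ⟨a, b, hab, hb⟩ := h.exists_longest
  have hle := h.le _ _ h.gap
  have hlow := h.lower
  have hmo := h.shortest.1
  have h0 := hab.trichotomy h.gap
  by_cases hpar : (d - c) % 2 = 1
  · rcases h.cost_cases with hc | hc | hc <;> omega
  right
  obtain ⟨u, v, w, hs, hu, hv, hw, hc'⟩ := h.exists_pieces hab h.gap (by omega)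
  rw [show b - a = K by omega] at hs hc'
  rcases h.cost_cases with hc | hc | ⟨hc1, hc2, hc⟩
  · omega
  · omega
  · have := hc' hc
    clear h0 hc hc'
    generalize d - c = g at *
    refine ⟨by omega, fun _ _ => by omega⟩

/-- As N < 2K there is no second odd gap, and the cost bound K + 3 only allows gaps of length 2 with
a hub neighbour at distance K beyond an end, that is, gaps adjacent to the long one: at most one on
each side. -/
theorem length_of_shortest_eq_longest (h : Profile N K P K (K + 3) c d) (hlt : N < 2 * K) :
    N = K ∨ N = K + 2 ∨ N = K + 4 := by
  obtain ⟨a, b, hab, hb⟩ := h.exists_longest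
  obtain ⟨h6, h7, h8, h9, -⟩ := id hab
  have hmo := h.shortest.1
  have key : ∀ p q, IsGap N P p q → (p = a ∧ q = b) ∨ (p + 2 = a ∧ q = a) ∨
      (p = b ∧ q = b + 2) := by
    intro p q hpq
    obtain ⟨h1, h2, h3, h4, -⟩ := id hpq
    have h5 := hpq.trichotomy hab
    have h10 := h.le_odd h3 h4 h2 h1
    obtain ⟨y, hy⟩ := exists_gapCost N P K p q
    have hle := h.cost_le p q y hpq hy
    rcases hy with hy | ⟨hy1, hy2, hy⟩ | hy
    · omega
    · rcases hy with ⟨hy3, hy⟩ | ⟨hy3, hy⟩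
      · have := hab.le_or_le hy
        omega
      · have := hab.le_or_le hy
        omega
    · omega
  have hleft : a = 0 ∨ a = 2 := by
    by_contra! hc
    obtain ⟨p, q, hpq, h1, h2⟩ := exists_gap_around h.zero h.last (show 0 < N by omega)
    have := key p q hpq
    omega
  have hright : N = b ∨ N = b + 2 := by
    by_contra! hc
    obtain ⟨p, q, hpq, h1, h2⟩ := exists_gap_around h.zero h.last (show N - 1 < N by omega)
    have := key p q hpq
    have := hpq.2.1
    omega
  omega

theorem ne_of_odd (h : Profile N K P m x c d) (hK : K % 2 = 1) (hN : N % 2 = 1)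
    (hlt : N < 2 * K) (h2 : N ≠ K + 2) (h4 : N ≠ K + 4) : x ≠ K + 3 := by
  rintro rfl
  obtain ⟨a, b, hab, hb⟩ := h.exists_longest
  obtain ⟨e, f, hef, hf, hmo⟩ := h.exists_shortest
  have hle := h.le _ _ h.gap
  have hlow := h.lower
  have g1 := hab.trichotomy hef
  have g2 := hab.trichotomy h.gap
  have g3 := hef.trichotomy h.gap
  have c1 := h.gap.1
  have hg : (d - c) % 2 = 0 ∧ (K + 2 = d - c + m ∨ K = d - c + m) := by
    rcases h.cost_cases with hc | hc | ⟨hc1, hc2, -⟩ <;> omega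
  by_cases hmK : m = K
  · subst hmK
    have := h.length_of_shortest_eq_longest hlt
    have := h.gap.2.1
    have := hab.2.1
    omega
  -- The longest gap, the shortest odd gap and the gap c, d are distinct, hence disjoint; `go` is
  -- applied to each of their six orders.
  have hp : ∃ u v w z, u + v + w + z + K + m + (d - c) = N ∧ (u % 2 = 0 ∨ m ≤ u) ∧
      (v % 2 = 0 ∨ m ≤ v) ∧ (w % 2 = 0 ∨ m ≤ w) ∧ (z % 2 = 0 ∨ m ≤ z) := by
    have go : ∀ a' b' r s e' f', IsGap N P a' b' → IsGap N P r s → IsGap N P e' f' →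
        b' ≤ r → s ≤ e' → (b' - a') + (s - r) + (f' - e') = K + m + (d - c) →
        ∃ u v w z, u + v + w + z + K + m + (d - c) = N ∧ (u % 2 = 0 ∨ m ≤ u) ∧
        (v % 2 = 0 ∨ m ≤ v) ∧ (w % 2 = 0 ∨ m ≤ w) ∧ (z % 2 = 0 ∨ m ≤ z) := by
      intro a' b' r s e' f' h1 h2 h3 h4 h5 h6
      obtain ⟨u, v, w, z, hs, hr⟩ := h.exists_four_pieces h1 h2 h3 h4 h5
      exact ⟨u, v, w, z, by omega, hr⟩
    have hKb : b - a = K := by omega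
    have hmf : f - e = m := by omega
    rcases g1 with g1 | g1 | g1
    · rcases g2 with g2 | g2 | g2
      · rcases g3 with g3 | g3 | g3
        · exact go _ _ _ _ _ _ hab hef h.gap g1 g3 (by omega)
        · exact go _ _ _ _ _ _ hab h.gap hef g2 g3 (by omega)
        · omega
      · exact go _ _ _ _ _ _ h.gap hab hef g2 g1 (by omega)
      · omega
    · rcases g2 with g2 | g2 | g2
      · exact go _ _ _ _ _ _ hef hab h.gap g1 g2 (by omega)
      · rcases g3 with g3 | g3 | g3
        · exact go _ _ _ _ _ _ hef h.gap hab g3 g2 (by omega)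
        · exact go _ _ _ _ _ _ h.gap hef hab g3 g1 (by omega)
        · omega
      · omega
    · omega
  obtain ⟨u, v, w, z, hs, hu, hv, hw, hz⟩ := hp
  clear g1 g2 g3
  generalize d - c = g at *
  -- K + m + g is even and N is odd, so one of the four pieces is odd and at least m; with K ≤ m + g
  -- this contradicts N < 2K.
  have : 2 * K ≤ K + m + m + g := by omega
  omega

end Profile

/-! ### Explicit configurations -/

/-- Gaps `k + 1, 1, …, 1`. -/
theorem mem_ones_odd {k : ℕ} (hN : 3 ≤ N) (hk : k % 2 = 0) (h : k + 2 ≤ N) :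
    k + 2 ∈ exponentSet (pscRun (N + 2) k) := by
  refine mem_exponentSet_pscRun (m := 1) (a := 0) (p := 0) (q := k + 1)
    (P := fun t => t = 0 ∨ (k + 1 ≤ t ∧ t ≤ N)) hN ?_ ?_ ?_ ?_ ?_ ?_ ?_
  all_goals try unfold IsGap
  all_goals try unfold IsShortestOdd
  all_goals try unfold SpanBound
  all_goals try unfold GapCost
  all_goals beta_reduce
  · omega
  · omega
  · exact ⟨by omega, by omega, by omega, by omega, fun t _ _ => by omega⟩
  · exact ⟨by omega, ⟨k + 1, by omega⟩, fun p q hp hq _ _ _ => by omega⟩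
  · intro u hu
    by_cases h : u < k + 1
    · exact ⟨0, k + 1, by omega⟩
    exact ⟨u, u + 1, by omega⟩
  · exact ⟨by omega, by omega, by omega, by omega, fun t _ _ => by omega⟩
  · omega

/-- Gaps `k + 1, 1, …, 1`. -/
theorem mem_ones_even {k : ℕ} (hN : 3 ≤ N) (hk : k % 2 = 1) (h : k + 2 ≤ N) :
    k + 3 ∈ exponentSet (pscRun (N + 2) k) := by
  refine mem_exponentSet_pscRun (m := 1) (a := 0) (p := 0) (q := k + 1)
    (P := fun t => t = 0 ∨ (k + 1 ≤ t ∧ t ≤ N)) hN ?_ ?_ ?_ ?_ ?_ ?_ ?_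
  all_goals try unfold IsGap
  all_goals try unfold IsShortestOdd
  all_goals try unfold SpanBound
  all_goals try unfold GapCost
  all_goals beta_reduce
  · omega
  · omega
  · exact ⟨by omega, by omega, by omega, by omega, fun t _ _ => by omega⟩
  · exact ⟨by omega, ⟨k + 1, by omega⟩, fun p q hp hq _ _ _ => by omega⟩
  · intro u hu
    by_cases h : u < k + 1
    · exact ⟨0, k + 1, by omega⟩
    exact ⟨u, u + 1, by omega⟩
  · exact ⟨by omega, by omega, by omega, by omega, fun t _ _ => by omega⟩
  · omega

/-- The single gap `k + 1`. -/
theorem mem_single {k : ℕ} (hN : 3 ≤ N) (hk : k % 2 = 0) (h : k + 1 = N) :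
    k + 2 ∈ exponentSet (pscRun (N + 2) k) := by
  refine mem_exponentSet_pscRun (m := k + 1) (a := 0) (p := 0) (q := k + 1)
    (P := fun t => t = 0 ∨ t = N) hN ?_ ?_ ?_ ?_ ?_ ?_ ?_
  all_goals try unfold IsGap
  all_goals try unfold IsShortestOdd
  all_goals try unfold SpanBound
  all_goals try unfold GapCost
  all_goals beta_reduce
  · omega
  · omega
  · exact ⟨by omega, by omega, by omega, by omega, fun t _ _ => by omega⟩
  · exact ⟨by omega, ⟨0, by omega⟩, fun p q hp hq _ _ _ => by omega⟩
  · intro u hu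
    exact ⟨0, k + 1, by omega⟩
  · exact ⟨by omega, by omega, by omega, by omega, fun t _ _ => by omega⟩
  · omega

/-- Gaps `g, k + 1, 2, …, 2`. -/
theorem mem_odd_odd {k g : ℕ} (hN : 3 ≤ N) (hk : k % 2 = 0) (h : g + k + 1 ≤ N)
    (hN' : N % 2 = 1) (hg : g % 2 = 0) (hg4 : 4 ≤ g) (hgk : g ≤ k) :
    k + 2 + g ∈ exponentSet (pscRun (N + 2) k) := by
  refine mem_exponentSet_pscRun (m := k + 1) (a := g) (p := 0) (q := g)
    (P := fun t => t = 0 ∨ t = g ∨ (g + k + 1 ≤ t ∧ t ≤ N ∧ t % 2 = 1)) hN ?_ ?_ ?_ ?_ ?_ ?_ ?_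
  all_goals try unfold IsGap
  all_goals try unfold IsShortestOdd
  all_goals try unfold SpanBound
  all_goals try unfold GapCost
  all_goals beta_reduce
  · omega
  · omega
  · exact ⟨by omega, by omega, by omega, by omega, fun t _ _ => by omega⟩
  · exact ⟨by omega, ⟨g, by omega⟩, fun p q hp hq _ _ _ => by omega⟩
  · intro u hu
    by_cases h : u < g
    · exact ⟨0, g, by omega⟩
    by_cases h : u < g + k + 1
    · exact ⟨g, g + k + 1, by omega⟩
    -- Rounding u down to an odd number gives the left end of its gap of length 2. Such a gap costs
    -- at most k + 6, whence the condition 4 ≤ g.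
    exact ⟨u - (u + 1) % 2, u - (u + 1) % 2 + 2, by omega⟩
  · exact ⟨by omega, by omega, by omega, by omega, fun t _ _ => by omega⟩
  · omega

/-- Gaps `k + 1, 2`. -/
theorem mem_two_right {k : ℕ} (hN : 3 ≤ N) (hk : k % 2 = 0) (hk2 : 2 ≤ k) (h : N = k + 3) :
    k + 4 ∈ exponentSet (pscRun (N + 2) k) := by
  refine mem_exponentSet_pscRun (m := k + 1) (a := 0) (p := k + 1) (q := N)
    (P := fun t => t = 0 ∨ t = k + 1 ∨ t = N) hN ?_ ?_ ?_ ?_ ?_ ?_ ?_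
  all_goals try unfold IsGap
  all_goals try unfold IsShortestOdd
  all_goals try unfold SpanBound
  all_goals try unfold GapCost
  all_goals beta_reduce
  · omega
  · omega
  · exact ⟨by omega, by omega, by omega, by omega, fun t _ _ => by omega⟩
  · exact ⟨by omega, ⟨0, by omega⟩, fun p q hp hq _ _ _ => by omega⟩
  · intro u hu
    by_cases h : u < k + 1
    · exact ⟨0, k + 1, by omega⟩
    exact ⟨k + 1, N, by omega⟩
  · exact ⟨by omega, by omega, by omega, by omega, fun t _ _ => by omega⟩
  · omega

/-- Gaps `2, k + 1, 2`. -/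
theorem mem_two_both {k : ℕ} (hN : 3 ≤ N) (hk : k % 2 = 0) (hk2 : 2 ≤ k) (h : N = k + 5) :
    k + 4 ∈ exponentSet (pscRun (N + 2) k) := by
  refine mem_exponentSet_pscRun (m := k + 1) (a := 2) (p := k + 3) (q := N)
    (P := fun t => t = 0 ∨ t = 2 ∨ t = k + 3 ∨ t = N) hN ?_ ?_ ?_ ?_ ?_ ?_ ?_
  all_goals try unfold IsGap
  all_goals try unfold IsShortestOdd
  all_goals try unfold SpanBound
  all_goals try unfold GapCost
  all_goals beta_reduce
  · omega
  · omega
  · exact ⟨by omega, by omega, by omega, by omega, fun t _ _ => by omega⟩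
  · exact ⟨by omega, ⟨2, by omega⟩, fun p q hp hq _ _ _ => by omega⟩
  · intro u hu
    by_cases h : u < 2
    · exact ⟨0, 2, by omega⟩
    by_cases h : u < k + 3
    · exact ⟨2, k + 3, by omega⟩
    exact ⟨k + 3, N, by omega⟩
  · exact ⟨by omega, by omega, by omega, by omega, fun t _ _ => by omega⟩
  · omega

/-- Gaps `k, k + 1, 1, …, 1`. -/
theorem mem_add_four {k : ℕ} (hN : 3 ≤ N) (hk : k % 2 = 0) (hk2 : 2 ≤ k) (h : 2 * k + 2 ≤ N) :
    k + 4 ∈ exponentSet (pscRun (N + 2) k) := by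
  refine mem_exponentSet_pscRun (m := 1) (a := k) (p := 0) (q := k)
    (P := fun t => t = 0 ∨ t = k ∨ (2 * k + 1 ≤ t ∧ t ≤ N)) hN ?_ ?_ ?_ ?_ ?_ ?_ ?_
  all_goals try unfold IsGap
  all_goals try unfold IsShortestOdd
  all_goals try unfold SpanBound
  all_goals try unfold GapCost
  all_goals beta_reduce
  · omega
  · omega
  · exact ⟨by omega, by omega, by omega, by omega, fun t _ _ => by omega⟩
  · exact ⟨by omega, ⟨2 * k + 1, by omega⟩, fun p q hp hq _ _ _ => by omega⟩
  · intro u hu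
    by_cases h : u < k
    · exact ⟨0, k, by omega⟩
    by_cases h : u < 2 * k + 1
    · exact ⟨k, 2 * k + 1, by omega⟩
    exact ⟨u, u + 1, by omega⟩
  · exact ⟨by omega, by omega, by omega, by omega, fun t _ _ => by omega⟩
  · omega

/-- Gaps `k + 1, 2, …, 2, k`. -/
theorem mem_top_odd_odd {k : ℕ} (hN : 3 ≤ N) (hk : k % 2 = 0) (hk2 : 2 ≤ k) (h : 2 * k + 3 ≤ N)
    (hN' : N % 2 = 1) :
    2 * k + 4 ∈ exponentSet (pscRun (N + 2) k) := by
  -- The last gap is isolated: N - k - m is even and positive, whereas the hub neighbours strictly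
  -- inside the path are odd up to N - k.
  refine mem_exponentSet_pscRun (m := k + 1) (a := 0) (p := N - k) (q := N)
    (P := fun t => t = 0 ∨ (k + 1 ≤ t ∧ t ≤ N - k ∧ t % 2 = 1) ∨ t = N) hN ?_ ?_ ?_ ?_ ?_ ?_ ?_
  all_goals try unfold IsGap
  all_goals try unfold IsShortestOdd
  all_goals try unfold SpanBound
  all_goals try unfold GapCost
  all_goals beta_reduce
  · omega
  · omega
  · exact ⟨by omega, by omega, by omega, by omega, fun t _ _ => by omega⟩
  · exact ⟨by omega, ⟨0, by omega⟩, fun p q hp hq _ _ _ => by omega⟩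
  · intro u hu
    by_cases h : u < k + 1
    · exact ⟨0, k + 1, by omega⟩
    by_cases h : u < N - k
    · exact ⟨u - (u + 1) % 2, u - (u + 1) % 2 + 2, by omega⟩
    exact ⟨N - k, N, by omega⟩
  · exact ⟨by omega, by omega, by omega, by omega, fun t _ _ => by omega⟩
  · omega

/-- Gaps `k + 1, m, 2, …, 2`. -/
theorem mem_even_odd {k m : ℕ} (hN : 3 ≤ N) (hk : k % 2 = 1) (hk3 : 3 ≤ k)
    (h : k + 1 + m ≤ N) (hN' : N % 2 = 1) (hm : m % 2 = 1) (hmk : m ≤ k) :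
    k + 2 + m ∈ exponentSet (pscRun (N + 2) k) := by
  refine mem_exponentSet_pscRun (m := m) (a := 0) (p := 0) (q := k + 1)
    (P := fun t => t = 0 ∨ t = k + 1 ∨ (k + 1 + m ≤ t ∧ t ≤ N ∧ t % 2 = 1)) hN ?_ ?_ ?_ ?_ ?_ ?_ ?_
  all_goals try unfold IsGap
  all_goals try unfold IsShortestOdd
  all_goals try unfold SpanBound
  all_goals try unfold GapCost
  all_goals beta_reduce
  · omega
  · omega
  · exact ⟨by omega, by omega, by omega, by omega, fun t _ _ => by omega⟩
  · exact ⟨by omega, ⟨k + 1, by omega⟩, fun p q hp hq _ _ _ => by omega⟩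
  · intro u hu
    by_cases h : u < k + 1
    · exact ⟨0, k + 1, by omega⟩
    by_cases h : u < k + 1 + m
    · exact ⟨k + 1, k + 1 + m, by omega⟩
    exact ⟨u - (u + 1) % 2, u - (u + 1) % 2 + 2, by omega⟩
  · exact ⟨by omega, by omega, by omega, by omega, fun t _ _ => by omega⟩
  · omega

/-- Gaps `k, 2, …, 2, k + 1`. -/
theorem mem_top_even_odd {k : ℕ} (hN : 3 ≤ N) (hk : k % 2 = 1) (h : 2 * k + 3 ≤ N) (hN' : N % 2 = 1) :
    2 * k + 4 ∈ exponentSet (pscRun (N + 2) k) := by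
  refine mem_exponentSet_pscRun (m := k) (a := N - (k + 1)) (p := N - (k + 1)) (q := N)
    (P := fun t => t = 0 ∨ (k ≤ t ∧ t ≤ N - (k + 1) ∧ t % 2 = 1) ∨ t = N) hN ?_ ?_ ?_ ?_ ?_ ?_ ?_
  all_goals try unfold IsGap
  all_goals try unfold IsShortestOdd
  all_goals try unfold SpanBound
  all_goals try unfold GapCost
  all_goals beta_reduce
  · omega
  · omega
  · exact ⟨by omega, by omega, by omega, by omega, fun t _ _ => by omega⟩
  · exact ⟨by omega, ⟨0, by omega⟩, fun p q hp hq _ _ _ => by omega⟩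
  · intro u hu
    by_cases h : u < k
    · exact ⟨0, k, by omega⟩
    by_cases h : u < N - (k + 1)
    · exact ⟨u - (u + 1) % 2, u - (u + 1) % 2 + 2, by omega⟩
    exact ⟨N - (k + 1), N, by omega⟩
  · exact ⟨by omega, by omega, by omega, by omega, fun t _ _ => by omega⟩
  · omega

/-- Gaps `k + 1, m, m, 2, …, 2`. -/
theorem mem_even_even {k m : ℕ} (hN : 3 ≤ N) (hk : k % 2 = 1) (hk3 : 3 ≤ k)
    (h : k + 1 + 2 * m ≤ N) (hN' : N % 2 = 0) (hm : m % 2 = 1) (hmk : m ≤ k) :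
    k + 2 + m ∈ exponentSet (pscRun (N + 2) k) := by
  refine mem_exponentSet_pscRun (m := m) (a := 0) (p := 0) (q := k + 1)
    (P := fun t => t = 0 ∨ t = k + 1 ∨ t = k + 1 + m ∨
      (k + 1 + 2 * m ≤ t ∧ t ≤ N ∧ t % 2 = 0)) hN ?_ ?_ ?_ ?_ ?_ ?_ ?_
  all_goals try unfold IsGap
  all_goals try unfold IsShortestOdd
  all_goals try unfold SpanBound
  all_goals try unfold GapCost
  all_goals beta_reduce
  · omega
  · omega
  · exact ⟨by omega, by omega, by omega, by omega, fun t _ _ => by omega⟩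
  · exact ⟨by omega, ⟨k + 1, by omega⟩, fun p q hp hq _ _ _ => by omega⟩
  · intro u hu
    by_cases h : u < k + 1
    · exact ⟨0, k + 1, by omega⟩
    by_cases h : u < k + 1 + m
    · exact ⟨k + 1, k + 1 + m, by omega⟩
    by_cases h : u < k + 1 + 2 * m
    · exact ⟨k + 1 + m, k + 1 + 2 * m, by omega⟩
    exact ⟨u - u % 2, u - u % 2 + 2, by omega⟩
  · exact ⟨by omega, by omega, by omega, by omega, fun t _ _ => by omega⟩
  · omega

/-- Gaps `k + 1, 2, …, 2, k, k`. -/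
theorem mem_top_even_even {k : ℕ} (hN : 3 ≤ N) (hk : k % 2 = 1) (h : 3 * k + 3 ≤ N) (hN' : N % 2 = 0) :
    2 * k + 4 ∈ exponentSet (pscRun (N + 2) k) := by
  refine mem_exponentSet_pscRun (m := k) (a := 0) (p := 0) (q := k + 1)
    (P := fun t => t = 0 ∨ (k + 1 ≤ t ∧ t ≤ N - 2 * k ∧ t % 2 = 0) ∨ t = N - k ∨ t = N) hN ?_ ?_ ?_ ?_ ?_ ?_ ?_
  all_goals try unfold IsGap
  all_goals try unfold IsShortestOdd
  all_goals try unfold SpanBound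
  all_goals try unfold GapCost
  all_goals beta_reduce
  · omega
  · omega
  · exact ⟨by omega, by omega, by omega, by omega, fun t _ _ => by omega⟩
  · exact ⟨by omega, ⟨N - k, by omega⟩, fun p q hp hq _ _ _ => by omega⟩
  · intro u hu
    by_cases h : u < k + 1
    · exact ⟨0, k + 1, by omega⟩
    by_cases h : u < N - 2 * k
    · exact ⟨u - u % 2, u - u % 2 + 2, by omega⟩
    by_cases h : u < N - k
    · exact ⟨N - 2 * k, N - k, by omega⟩
    exact ⟨N - k, N, by omega⟩
  · exact ⟨by omega, by omega, by omega, by omega, fun t _ _ => by omega⟩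
  · omega

/-- Gaps `k + 1, k + 1, 2, …, 2, k`. -/
theorem mem_top_odd_even {k : ℕ} (hN : 3 ≤ N) (hk : k % 2 = 0) (hk2 : 2 ≤ k) (h : 3 * k + 4 ≤ N)
    (hN' : N % 2 = 0) :
    2 * k + 4 ∈ exponentSet (pscRun (N + 2) k) := by
  refine mem_exponentSet_pscRun (m := k + 1) (a := 0) (p := N - k) (q := N)
    (P := fun t => t = 0 ∨ t = k + 1 ∨ (2 * k + 2 ≤ t ∧ t ≤ N - k ∧ t % 2 = 0) ∨ t = N) hN ?_ ?_ ?_ ?_ ?_ ?_ ?_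
  all_goals try unfold IsGap
  all_goals try unfold IsShortestOdd
  all_goals try unfold SpanBound
  all_goals try unfold GapCost
  all_goals beta_reduce
  · omega
  · omega
  · exact ⟨by omega, by omega, by omega, by omega, fun t _ _ => by omega⟩
  · exact ⟨by omega, ⟨0, by omega⟩, fun p q hp hq _ _ _ => by omega⟩
  · intro u hu
    by_cases h : u < k + 1
    · exact ⟨0, k + 1, by omega⟩
    by_cases h : u < 2 * k + 2
    · exact ⟨k + 1, 2 * k + 2, by omega⟩
    by_cases h : u < N - k
    · exact ⟨u - u % 2, u - u % 2 + 2, by omega⟩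
    exact ⟨N - k, N, by omega⟩
  · exact ⟨by omega, by omega, by omega, by omega, fun t _ _ => by omega⟩
  · omega

/-- Gaps `k + 1, 2, m, m`. -/
theorem mem_isolated_even_even {k m : ℕ} (hN : 3 ≤ N) (hk : k % 2 = 1) (h : k + 3 + 2 * m = N)
    (hm : m % 2 = 1) (hmk : m ≤ k) :
    k + 4 + m ∈ exponentSet (pscRun (N + 2) k) := by
  refine mem_exponentSet_pscRun (m := m) (a := 0) (p := 0) (q := k + 1)
    (P := fun t => t = 0 ∨ t = k + 1 ∨ t = k + 3 ∨ t = k + 3 + m ∨ t = N) hN ?_ ?_ ?_ ?_ ?_ ?_ ?_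
  all_goals try unfold IsGap
  all_goals try unfold IsShortestOdd
  all_goals try unfold SpanBound
  all_goals try unfold GapCost
  all_goals beta_reduce
  · omega
  · omega
  · exact ⟨by omega, by omega, by omega, by omega, fun t _ _ => by omega⟩
  · exact ⟨by omega, ⟨k + 3, by omega⟩, fun p q hp hq _ _ _ => by omega⟩
  · intro u hu
    by_cases h : u < k + 1
    · exact ⟨0, k + 1, by omega⟩
    by_cases h : u < k + 3
    · exact ⟨k + 1, k + 3, by omega⟩
    by_cases h : u < k + 3 + m
    · exact ⟨k + 3, k + 3 + m, by omega⟩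
    exact ⟨k + 3 + m, N, by omega⟩
  · exact ⟨by omega, by omega, by omega, by omega, fun t _ _ => by omega⟩
  · omega

/-- Gaps `g, k + 1, k - 1, 2, …, 2`. -/
theorem mem_odd_even {k g : ℕ} (hN : 3 ≤ N) (hk : k % 2 = 0) (h : g + 2 * k ≤ N) (hN' : N % 2 = 0)
    (hg : g % 2 = 0) (hg2 : 2 ≤ g) (hgk : g ≤ k) :
    k + 2 + g ∈ exponentSet (pscRun (N + 2) k) := by
  -- The gap g is isolated because g + m falls strictly inside the gap k + 1.
  refine mem_exponentSet_pscRun (m := k - 1) (a := g) (p := 0) (q := g)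
    (P := fun t => t = 0 ∨ t = g ∨ t = g + k + 1 ∨ (g + 2 * k ≤ t ∧ t ≤ N ∧ t % 2 = 0)) hN ?_ ?_ ?_ ?_ ?_ ?_ ?_
  all_goals try unfold IsGap
  all_goals try unfold IsShortestOdd
  all_goals try unfold SpanBound
  all_goals try unfold GapCost
  all_goals beta_reduce
  · omega
  · omega
  · exact ⟨by omega, by omega, by omega, by omega, fun t _ _ => by omega⟩
  · exact ⟨by omega, ⟨g + k + 1, by omega⟩, fun p q hp hq _ _ _ => by omega⟩
  · intro u hu
    by_cases h : u < g
    · exact ⟨0, g, by omega⟩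
    by_cases h : u < g + k + 1
    · exact ⟨g, g + k + 1, by omega⟩
    by_cases h : u < g + 2 * k
    · exact ⟨g + k + 1, g + 2 * k, by omega⟩
    exact ⟨u - u % 2, u - u % 2 + 2, by omega⟩
  · exact ⟨by omega, by omega, by omega, by omega, fun t _ _ => by omega⟩
  · omega


/-! ### The exponent sets, by the parities of N and of K = k + 1 -/

variable {k : ℕ}

theorem mem_evenIcc {a b x : ℕ} : x ∈ evenIcc a b ↔ (a ≤ x ∧ x ≤ b) ∧ x % 2 = 0 := by
  rw [← Nat.even_iff]
  rfl

theorem exponentSet_pscRun_odd_even (hN : 3 ≤ N) (hk : k % 2 = 1) (hN' : N % 2 = 1)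
    (hkN : k + 1 ≤ N) (u : ℕ) (hu : (u = 2 * k + 4 ∧ 2 * k + 3 ≤ N) ∨
      (u = N + 1 ∧ N < 2 * k + 3)) :
    exponentSet (pscRun (N + 2) k) = evenIcc (k + 2) u := by
  ext x
  rw [mem_evenIcc]
  constructor
  · intro hx
    obtain ⟨P, m, c, d, h⟩ := exists_profile hN hx
    have := h.even
    have := h.lower
    have := h.upper
    have := h.le_length_add_one
    omega
  · intro hx
    by_cases h1 : x = 2 * k + 4
    · subst h1
      exact mem_top_even_odd hN hk (by omega) hN'
    by_cases hx3 : x = k + 3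
    · subst hx3
      exact mem_ones_even hN hk (by omega)
    obtain ⟨m, rfl⟩ : ∃ m, x = k + 2 + m := ⟨x - (k + 2), by omega⟩
    exact mem_even_odd hN hk (by omega) (by omega) hN' (by omega) (by omega)

theorem exponentSet_pscRun_even_even (hN : 3 ≤ N) (hk : k % 2 = 1) (hN' : N % 2 = 0)
    (hkN : k + 3 ≤ N) (u : ℕ) (hu : (u = 2 * k + 4 ∧ 3 * k + 3 ≤ N) ∨
      (N ≤ 3 * k + 1 ∧ ∃ q, (u = k + 2 * q + 3 ∧ N = k + 4 * q + 3) ∨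
        (u = k + 2 * q + 5 ∧ N = k + 4 * q + 5))) :
    exponentSet (pscRun (N + 2) k) = evenIcc (k + 2) u := by
  ext x
  rw [mem_evenIcc]
  constructor
  · intro hx
    obtain ⟨P, m, c, d, h⟩ := exists_profile hN hx
    have := h.even
    have := h.lower
    have := h.upper
    have := h.upper_even_even (by omega) hN'
    have := h.shortest.1
    rcases hu with hu | ⟨-, q, hu⟩ <;> omega
  · intro hx
    by_cases hx3 : x = k + 3
    · subst hx3
      exact mem_ones_even hN hk (by omega)
    obtain ⟨m, rfl⟩ : ∃ m, x = k + 2 + m := ⟨x - (k + 2), by omega⟩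
    rcases hu with ⟨rfl, hu⟩ | ⟨hNk, q, ⟨rfl, hu⟩ | ⟨rfl, hu⟩⟩
    · by_cases h1 : m = k + 2
      · subst h1
        rw [show k + 2 + (k + 2) = 2 * k + 4 by omega]
        exact mem_top_even_even hN hk (by omega) hN'
      · exact mem_even_even hN hk (by omega) (by omega) hN' (by omega) (by omega)
    · exact mem_even_even hN hk (by omega) (by omega) hN' (by omega) (by omega)
    -- The top value would need a longer path with gaps k + 1, m, m, so it uses an isolated gap k +
    -- 1 and a shortest odd gap 2q + 1.
    · by_cases h1 : m = 2 * q + 3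
      · subst h1
        rw [show k + 2 + (2 * q + 3) = k + 4 + (2 * q + 1) by omega]
        exact mem_isolated_even_even hN hk (by omega) (by omega) (by omega)
      · exact mem_even_even hN hk (by omega) (by omega) hN' (by omega) (by omega)

theorem exponentSet_pscRun_odd_odd (hN : 3 ≤ N) (hk : k % 2 = 0) (hk2 : 2 ≤ k)
    (hN' : N % 2 = 1) (hkN : k + 1 ≤ N) (u : ℕ) (S : Set ℕ)
    (hu : (u = 2 * k + 4 ∧ 2 * k + 3 ≤ N) ∨ (u = N + 1 ∧ N < 2 * k + 3))
    (hS : (S = ∅ ∧ (2 * k + 2 ≤ N ∨ N = k + 3 ∨ N = k + 5)) ∨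
      (S = {k + 4} ∧ N < 2 * k + 2 ∧ N ≠ k + 3 ∧ N ≠ k + 5)) :
    exponentSet (pscRun (N + 2) k) = evenIcc (k + 2) u \ S := by
  have hS' : ∀ x, x ∉ S ↔
      ((2 * k + 2 ≤ N ∨ N = k + 3 ∨ N = k + 5) ∨ x ≠ k + 4) := by
    intro x
    rcases hS with ⟨rfl, h⟩ | ⟨rfl, h⟩
    · simp [h]
    · simp only [Set.mem_singleton_iff]
      omega
  ext x
  rw [Set.mem_sdiff, mem_evenIcc, hS']
  constructor
  · intro hx
    obtain ⟨P, m, c, d, h⟩ := exists_profile hN hx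
    have := h.even
    have := h.lower
    have := h.upper
    have := h.le_length_add_one
    have := h.ne_of_odd (by omega) hN'
    omega
  · intro hx
    by_cases h1 : x = 2 * k + 4
    · subst h1
      exact mem_top_odd_odd hN hk hk2 (by omega) hN'
    obtain ⟨g, rfl⟩ : ∃ g, x = k + 2 + g := ⟨x - (k + 2), by omega⟩
    by_cases h2 : g = 0
    · subst h2
      by_cases h3 : k + 1 = N
      · exact mem_single hN hk h3
      · exact mem_ones_odd hN hk (by omega)
    -- The value k + 4 is exceptional: it needs either a long path or one of the two sporadic
    -- lengths, in which gaps of length 2 adjoin the long one.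
    by_cases h3 : g = 2
    · subst h3
      rcases hx.2 with (h | h | h) | h
      · exact mem_add_four hN hk hk2 h
      · exact mem_two_right hN hk hk2 h
      · exact mem_two_both hN hk hk2 h
      · omega
    · exact mem_odd_odd hN hk (by omega) hN' (by omega) (by omega) (by omega)

theorem exponentSet_pscRun_even_odd (hN : 3 ≤ N) (hk : k % 2 = 0) (hk2 : 2 ≤ k)
    (hN' : N % 2 = 0) (hkN : k + 2 ≤ N) (u : ℕ)
    (hu : (u = 2 * k + 4 ∧ 3 * k + 4 ≤ N) ∨ (u = 2 * k + 2 ∧ N = 3 * k + 2) ∨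
      (u + k = N + 2 ∧ 2 * k + 2 ≤ N ∧ N ≤ 3 * k) ∨ (u = k + 2 ∧ N ≤ 2 * k)) :
    exponentSet (pscRun (N + 2) k) = evenIcc (k + 2) u := by
  ext x
  rw [mem_evenIcc]
  constructor
  · intro hx
    obtain ⟨P, m, c, d, h⟩ := exists_profile hN hx
    have := h.even
    have := h.lower
    have := h.upper
    have := h.upper_even_odd (by omega) hN'
    omega
  · intro hx
    by_cases h1 : x = 2 * k + 4
    · subst h1
      exact mem_top_odd_even hN hk hk2 (by omega) hN'
    obtain ⟨g, rfl⟩ : ∃ g, x = k + 2 + g := ⟨x - (k + 2), by omega⟩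
    by_cases h2 : g = 0
    · subst h2
      exact mem_ones_odd hN hk (by omega)
    · exact mem_odd_even hN hk (by omega) hN' (by omega) (by omega) (by omega)

end SymCompanion

/-! ### Assembly of the theorem -/

open SymCompanion in
theorem mainTheorem5 (n k : ℕ) (hn : 5 ≤ n) (hk : 1 ≤ k) :
    ((Odd n ∧ 2 * (k + 2) + 1 ≤ n) ∨ (Even n ∧ 3 * (k + 2) - 1 ≤ n) →
      exponentSet (pscRun n k) = evenIcc (k + 2) (2 * (k + 2))) ∧
    (Odd k → n ∈ oddIcc (k + 3) (2 * (k + 2) - 1) →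
      exponentSet (pscRun n k) = evenIcc (k + 2) (n - 1)) ∧
    (Even k →
      (n ∈ oddIcc (k + 3) (2 * (k + 2) - 1) \ {k + 5, k + 7} →
        exponentSet (pscRun n k) = evenIcc (k + 2) (n - 1) \ {k + 4}) ∧
      (n ∈ ({k + 5, k + 7} : Set ℕ) →
        exponentSet (pscRun n k) = evenIcc (k + 2) (n - 1))) ∧
    (Odd k → n ∈ evenIcc (k + 5) (3 * (k + 1)) →
      (n - k - 4 = 4 * ((n - k - 4) / 4) + 1 →
        exponentSet (pscRun n k) = evenIcc (k + 3) (k + 2 * ((n - k - 4) / 4) + 3)) ∧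
      (n - k - 4 = 4 * ((n - k - 4) / 4) + 3 →
        exponentSet (pscRun n k) = evenIcc (k + 3) (k + 2 * ((n - k - 4) / 4) + 5))) ∧
    (Even k →
      (n ∈ evenIcc (k + 4) (3 * k + 2) →
        (k + 2 < n - k → exponentSet (pscRun n k) = evenIcc (k + 2) (n - k)) ∧
        (n - k ≤ k + 2 → exponentSet (pscRun n k) = {k + 2})) ∧
      (n = 3 * (k + 1) + 1 →
        exponentSet (pscRun n k) = evenIcc (k + 2) (2 * (k + 1)))) := by
  obtain ⟨N, rfl⟩ : ∃ N, n = N + 2 := ⟨n - 2, by omega⟩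
  have hN : 3 ≤ N := by omega
  have hodd : ∀ {a b : ℕ}, N + 2 ∈ oddIcc a b → (a ≤ N + 2 ∧ N + 2 ≤ b) ∧ N % 2 = 1 := by
    rintro a b ⟨h1, h2⟩
    rw [Nat.odd_iff] at h2
    exact ⟨h1, by omega⟩
  refine ⟨fun h => ?_, fun hk' h => ?_, fun hk' => ⟨fun h => ?_, fun h => ?_⟩, fun hk' h => ?_,
    fun hk' => ⟨fun h => ?_, fun h => ?_⟩⟩
  · rw [Nat.odd_iff, Nat.even_iff] at h
    rcases Nat.mod_two_eq_zero_or_one k with hk' | hk' <;> rcases h with h | h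
    · rw [exponentSet_pscRun_odd_odd hN hk' (by omega) (by omega) (by omega) (2 * (k + 2)) ∅
        (by omega) (.inl ⟨rfl, by omega⟩), Set.sdiff_empty]
    · exact exponentSet_pscRun_even_odd hN hk' (by omega) (by omega) (by omega) _ (by omega)
    · exact exponentSet_pscRun_odd_even hN hk' (by omega) (by omega) _ (by omega)
    · exact exponentSet_pscRun_even_even hN hk' (by omega) (by omega) _ (.inl (by omega))
  · have := hodd h
    rw [Nat.odd_iff] at hk'
    exact exponentSet_pscRun_odd_even hN hk' (by omega) (by omega) _ (by omega)
  · have h1 := hodd h.1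
    have h2 := h.2
    rw [Nat.even_iff] at hk'
    simp only [Set.mem_insert_iff, Set.mem_singleton_iff] at h2
    exact exponentSet_pscRun_odd_odd hN hk' (by omega) (by omega) (by omega) _ _ (by omega)
      (.inr ⟨rfl, by omega⟩)
  · simp only [Set.mem_insert_iff, Set.mem_singleton_iff] at h
    rw [Nat.even_iff] at hk'
    rw [exponentSet_pscRun_odd_odd hN hk' (by omega) (by omega) (by omega) (N + 2 - 1) ∅
        (by omega) (.inl ⟨rfl, by omega⟩), Set.sdiff_empty]
  · rw [mem_evenIcc] at h
    rw [Nat.odd_iff] at hk'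
    -- As k is odd, k + 2 is odd, so both lower ends give the same even integers.
    have hshift : ∀ u, evenIcc (k + 2) u = evenIcc (k + 3) u := by
      intro u
      ext x
      rw [mem_evenIcc, mem_evenIcc]
      omega
    rw [← hshift, ← hshift]
    refine ⟨fun hd => ?_, fun hd => ?_⟩
    · exact exponentSet_pscRun_even_even hN hk' (by omega) (by omega) _
        (.inr ⟨by omega, (N + 2 - k - 4) / 4, by omega⟩)
    · exact exponentSet_pscRun_even_even hN hk' (by omega) (by omega) _
        (.inr ⟨by omega, (N + 2 - k - 4) / 4, by omega⟩)
  · rw [mem_evenIcc] at h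
    rw [Nat.even_iff] at hk'
    refine ⟨fun h' => ?_, fun h' => ?_⟩
    · exact exponentSet_pscRun_even_odd hN hk' (by omega) (by omega) (by omega) _ (by omega)
    · rw [exponentSet_pscRun_even_odd hN hk' (by omega) (by omega) (by omega) (k + 2)
        (by omega)]
      ext x
      rw [mem_evenIcc, Set.mem_singleton_iff]
      omega
  · rw [Nat.even_iff] at hk'
    exact exponentSet_pscRun_even_odd hN hk' (by omega) (by omega) (by omega) _ (by omega)
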